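/- Let $\alpha>0$, $\lambda>0$ and $H=\alpha+\frac12$. Let $\{Z_j\}_{j\in\mathbb Z}$ be i.i.d. real random variables with mean zero and finite variance. For $n\ge 1$ let $X_k^{\lambda/n}$ be the ARTFIMA$(0,\alpha,\lambda/n,0)$ series $$X_k^{\lambda/n}=\sum_{j=0}^{\infty}(-1)^j\binom{-\alpha}{j}e^{-\lambda j/n}\,Z_{k-j},\qquad k\in\mathbb Z,$$ where $\binom{-\alpha}{j}$ is the generalised binomial coefficient, and let $$T_n^{\lambda/n}(t)=\sum_{k=1}^{[t]}X_k^{\lambda/n}+(t-[t])\,X_{[t]+1}^{\lambda/n},\qquad t\ge0,$$ be its linearly interpolated partial sum. Let $B(dy)$ be an independently scattered Gaussian random measure on $\mathbb R$ with control measure $\sigma^2\,dy$, where $\sigma^2=\operatorname{Var}(Z_0)/\Gamma(\alpha)^2$, and let $$Z^1_{H,\lambda}(t)=\int_{\mathbb R}\int_0^t (s-y)^{H-\frac32}e^{-\lambda (s-y)}\mathbf 1_{\{s>y\}}\,ds\,B(dy)$$ be the tempered Hermite process of order one driven by $B$. (Equivalently, $Z^1_{H,\lambda}$ is $1/\Gamma(\alpha)$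 times the tempered Hermite process with control measure $\operatorname{Var}(Z_0)\,dy$.) Then, for every $n\ge1$, the series defining $X_k^{\lambda/n}$ converge absolutely with probability one; the process $Z^1_{H,\lambda}$ has a version with continuous paths on $[0,1]$; and, for every such version, $$n^{-H}\,T_n^{\lambda/n}(nt)\;\Rightarrow\; Z^1_{H,\lambda}(t)\qquad (n\to\infty)$$ weakly in $C[0,1]$, the space of continuous functions on $[0,1]$ with the uniform norm and its Borel $\sigma$-algebra. -/

import Mathlib

open MeasureTheory ProbabilityTheory Filter Topology

noncomputable section

namespace TemperedFractional

/-! ### The tempered fractional difference operator and the ARTFIMA series -/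

/-- The coefficient `(-1)^j * binom(a, j) * e^(-lam * j)`, with the generalised binomial
coefficient `binom(a, j) = a (a - 1) ⋯ (a - j + 1) / j!`, which makes sense for every real `a`. -/
def coeff (a lam : ℝ) (j : ℕ) : ℝ :=
  (-1) ^ j * Ring.choose a j * Real.exp (-(lam * j))

/-- The tempered fractional difference operator of order `a` and step `1`,
`(Δ^{a,lam} f)(k) = ∑_{j ≥ 0} (-1)^j binom(a, j) e^(-lam j) f(k - j)`. -/
def temperedDiff (a lam : ℝ) (f : ℤ → ℝ) (k : ℤ) : ℝ :=
  ∑' j : ℕ, coeff a lam j * f (k - j)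

/-- The ARTFIMA `(0, α, lam, 0)` series driven by the noise `Z`: `X = Δ^{-α,lam} Z`. -/
def artfima {Ω : Type*} (α lam : ℝ) (Z : ℤ → Ω → ℝ) (k : ℤ) (ω : Ω) : ℝ :=
  temperedDiff (-α) lam (fun i => Z i ω) k

/-! ### Linearly interpolated partial sums -/

/-- `∑_{k=1}^{[t]} x_k + (t - [t]) x_{[t]+1}` (used for `t ≥ 0`). -/
def partialSum (x : ℤ → ℝ) (t : ℝ) : ℝ :=
  ∑ k ∈ Finset.Icc 1 ⌊t⌋₊, x k + (t - ⌊t⌋₊) * x ((⌊t⌋₊ : ℤ) + 1)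

lemma partialSum_eq_on_Icc (x : ℤ → ℝ) (N : ℕ) (t : ℝ) (h1 : (N : ℝ) ≤ t) (h2 : t ≤ N + 1) :
    partialSum x t = ∑ k ∈ Finset.Icc 1 N, x k + (t - N) * x ((N : ℤ) + 1) := by
  rcases h2.lt_or_eq with h | h
  · have hf : ⌊t⌋₊ = N := (Nat.floor_eq_iff ((Nat.cast_nonneg N).trans h1)).2 ⟨h1, h⟩
    simp [partialSum, hf]
  · have hf : ⌊t⌋₊ = N + 1 := by
      rw [h]; exact_mod_cast Nat.floor_natCast (R := ℝ) (N + 1)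
    rw [partialSum, hf, Finset.sum_Icc_succ_top (by omega), h]
    push_cast
    ring

lemma continuousOn_partialSum (x : ℤ → ℝ) (N : ℕ) :
    ContinuousOn (partialSum x) (Set.Icc (0 : ℝ) N) := by
  induction N with
  | zero => simp
  | succ N ih =>
    have hN : (0 : ℝ) ≤ N := Nat.cast_nonneg N
    have hstep : ContinuousOn (partialSum x) (Set.Icc (N : ℝ) (N + 1)) := by
      refine ContinuousOn.congr
        (f := fun t => ∑ k ∈ Finset.Icc 1 N, x k + (t - N) * x ((N : ℤ) + 1)) ?_ ?_
      · fun_prop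
      · intro t ht
        exact partialSum_eq_on_Icc x N t ht.1 ht.2
    have := ih.union_of_isClosed hstep isClosed_Icc isClosed_Icc
    rwa [Set.Icc_union_Icc_eq_Icc hN (by linarith), ← Nat.cast_succ] at this

lemma continuous_partialSum_unitInterval (x : ℤ → ℝ) (n : ℕ) :
    Continuous fun t : unitInterval => partialSum x (n * (t : ℝ)) := by
  refine (continuousOn_partialSum x n).comp_continuous (by fun_prop) fun t => ?_
  have h0 := t.2.1
  have h1 := t.2.2
  have hn : (0 : ℝ) ≤ n := Nat.cast_nonneg n
  exact ⟨by positivity, by nlinarith⟩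

/-- The element `t ↦ n^(-H) * S(n t)` of `C[0,1]`, where `S` is the linearly interpolated
partial sum of the series `x`. -/
def scaledPath (H : ℝ) (n : ℕ) (x : ℤ → ℝ) : C(unitInterval, ℝ) where
  toFun t := (n : ℝ) ^ (-H) * partialSum x (n * (t : ℝ))
  continuous_toFun := continuous_const.mul (continuous_partialSum_unitInterval x n)

/-- `C[0,1]`, with the uniform topology, carries its Borel σ-algebra. -/
instance : MeasurableSpace C(unitInterval, ℝ) := borel _

instance : BorelSpace C(unitInterval, ℝ) := ⟨rfl⟩

/-! ### Gaussian random measures, the Wiener integral, the tempered Hermite process -/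

/-- `B` is an independently scattered Gaussian random measure on `ℝ` with control measure `m`,
under the probability measure `P`.  Only the values `B A` on Borel sets `A` with `m A < ∞`
matter; σ-additivity is in the sense of mean square convergence. -/
structure IsGaussianRandomMeasure {Ω : Type*} [MeasurableSpace Ω] (B : Set ℝ → Ω → ℝ)
    (m : Measure ℝ) (P : Measure Ω) : Prop where
  hasLaw : ∀ A, MeasurableSet A → m A < ⊤ → HasLaw (B A) (gaussianReal 0 (m A).toNNReal) P
  indep : ∀ A : ℕ → Set ℝ, (∀ i, MeasurableSet (A i)) → (∀ i, m (A i) < ⊤) →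
    Pairwise (Function.onFun Disjoint A) → iIndepFun (fun i => B (A i)) P
  additive : ∀ A : ℕ → Set ℝ, (∀ i, MeasurableSet (A i)) → m (⋃ i, A i) < ⊤ →
    Pairwise (Function.onFun Disjoint A) →
    Tendsto (fun N : ℕ => eLpNorm (fun ω => B (⋃ i, A i) ω - ∑ i ∈ Finset.range N, B (A i) ω) 2 P)
      atTop (𝓝 0)

/-- The integral of a simple function, `∑_c c * B(φ = c)`. -/
def simpleIntegral {Ω : Type*} (B : Set ℝ → Ω → ℝ) (φ : SimpleFunc ℝ ℝ) (ω : Ω) : ℝ :=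
  ∑ c ∈ φ.range, c * B (φ ⁻¹' {c}) ω

/-- `Y` is (a version of) the stochastic integral `∫ f dB`: `f ∈ L²(m)` and `Y` is the mean square
limit of the integrals of simple functions that converge to `f` in `L²(m)`. -/
def IsWienerIntegral {Ω : Type*} [MeasurableSpace Ω] (B : Set ℝ → Ω → ℝ) (m : Measure ℝ)
    (P : Measure Ω) (f : ℝ → ℝ) (Y : Ω → ℝ) : Prop :=
  MemLp f 2 m ∧ MemLp Y 2 P ∧
  ∃ φ : ℕ → SimpleFunc ℝ ℝ, (∀ i, MemLp (φ i) 2 m) ∧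
    Tendsto (fun i => eLpNorm (fun y => φ i y - f y) 2 m) atTop (𝓝 0) ∧
    Tendsto (fun i => eLpNorm (fun ω => simpleIntegral B (φ i) ω - Y ω) 2 P) atTop (𝓝 0)

/-- The kernel `y ↦ ∫_0^t (s - y)_+^(H - 3/2) e^(-lam (s - y)_+) ds`, where the integrand is
understood to vanish for `s ≤ y`. -/
def thpKernel (H lam t y : ℝ) : ℝ :=
  ∫ s in (0 : ℝ)..t,
    if 0 < s - y then (s - y) ^ (H - 3 / 2) * Real.exp (-(lam * (s - y))) else 0

/-- `ζ` is a tempered Hermite process of order one on the time interval `[0,1]`, with continuous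
paths, driven by the random measure `B` with control measure `m`. -/
def IsTHP {Ω : Type*} [MeasurableSpace Ω] (B : Set ℝ → Ω → ℝ) (m : Measure ℝ) (P : Measure Ω)
    (H lam : ℝ) (ζ : Ω → C(unitInterval, ℝ)) : Prop :=
  ∀ t : unitInterval, IsWienerIntegral B m P (thpKernel H lam t) (fun ω => ζ ω t)

end TemperedFractional

end

/-
Exchanging sums, `n^(-H) T_n(nt) = ∑_i w_n(t, i) Z_i`, where `w_n(t, ⌊ny⌋ + 1)` is `n^(-1/2)` times
the time integral over `[0, t]` of a step kernel in `s - y`. Binomial coefficient asymptotics make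
that step kernel converge to `Γ(α)⁻¹ (s - y)_+^(α-1) e^(-lam (s-y))`, under a majorant which is
integrable in `s` and does not depend on `n`.
Hence the variances of the finite linear combinations converge, and since the individual weights
are uniformly small, the characteristic functions of the finite-dimensional laws converge to the
Gaussian ones. The majorant also bounds the mean square increments of all these processes by
`C |s - t|^r` with a common `r > 1`; Kolmogorov's chaining argument then gives the continuous
version of the limit and, by a uniform dyadic approximation, the convergence in `C[0,1]`.
-/

noncomputable section

namespace TemperedFractional

/-! ### The Wiener integral -/

section Gaussian

variable {Ω : Type*} [MeasurableSpace Ω] {P : Measure Ω}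

lemma sq_eLpNorm_two {X : Type*} [MeasurableSpace X] {μ : Measure X} (f : X → ℝ) :
    eLpNorm f 2 μ ^ 2 = ∫⁻ x, ‖f x‖ₑ ^ 2 ∂μ := by
  have h := eLpNorm_nnreal_pow_eq_lintegral (f := f) (μ := μ) (p := 2) two_ne_zero
  simpa only [NNReal.coe_ofNat, ENNReal.coe_ofNat, ENNReal.rpow_ofNat] using h

lemma enorm_sq_eq_ofReal (x : ℝ) : ‖x‖ₑ ^ 2 = ENNReal.ofReal (x ^ 2) := by
  rw [Real.enorm_eq_ofReal_abs, ← ENNReal.ofReal_pow (abs_nonneg x), sq_abs]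

lemma memLp_of_hasLaw_gaussianReal {X : Ω → ℝ} {μ : ℝ} {v : NNReal}
    (hX : HasLaw X (gaussianReal μ v) P) : MemLp X 2 P := by
  refine (memLp_map_measure_iff aestronglyMeasurable_id hX.aemeasurable).1 ?_
  rw [hX.map_eq]
  exact memLp_id_gaussianReal' 2 ENNReal.ofNat_ne_top

lemma lintegral_sq_of_hasLaw_gaussianReal {X : Ω → ℝ} {v : NNReal}
    (hX : HasLaw X (gaussianReal 0 v) P) : ∫⁻ ω, ‖X ω‖ₑ ^ 2 ∂P = v := by
  have hvar : ∫ x, x ^ 2 ∂(gaussianReal 0 v) = v := by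
    have h := variance_id_gaussianReal (μ := 0) (v := v)
    rwa [variance_of_integral_eq_zero aemeasurable_id integral_id_gaussianReal] at h
  calc ∫⁻ ω, ‖X ω‖ₑ ^ 2 ∂P = ∫⁻ x, ENNReal.ofReal (x ^ 2) ∂(gaussianReal 0 v) := by
        rw [← hX.map_eq, lintegral_map' (by fun_prop) hX.aemeasurable]
        simp only [enorm_sq_eq_ofReal]
    _ = v := by
        have hinteg : Integrable (fun x : ℝ => x ^ 2) (gaussianReal 0 v) :=
          (memLp_id_gaussianReal' 2 ENNReal.ofNat_ne_top).integrable_sq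
        rw [← ofReal_integral_eq_lintegral_ofReal hinteg (ae_of_all _ sq_nonneg), hvar,
          ENNReal.ofReal_coe_nnreal]

lemma hasLaw_sum_gaussianReal {ι : Type*} {X : ι → Ω → ℝ} {v : ι → NNReal}
    (hindep : iIndepFun X P) (hX : ∀ i, HasLaw (X i) (gaussianReal 0 (v i)) P) (s : Finset ι) :
    HasLaw (∑ i ∈ s, X i) (gaussianReal 0 (∑ i ∈ s, v i)) P := by
  classical
  have := hindep.isProbabilityMeasure
  have hmeas i : AEMeasurable (X i) P := (hX i).aemeasurable
  induction s using Finset.induction_on with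
  | empty => exact ⟨aemeasurable_const, by simp [Pi.zero_def, Measure.map_const]⟩
  | insert i s hi ih =>
    rw [Finset.sum_insert hi, Finset.sum_insert hi]
    refine ⟨(hmeas i).add ih.aemeasurable, ?_⟩
    simpa using gaussianReal_add_gaussianReal_of_indepFun
      (hindep.indepFun_finsetSum_of_notMem₀ hmeas hi).symm (hX i).map_eq ih.map_eq

lemma hasLaw_gaussianReal_of_tendsto_eLpNorm [IsProbabilityMeasure P] {X : ℕ → Ω → ℝ} {Y : Ω → ℝ}
    {v : ℕ → NNReal} {w : NNReal} (hX : ∀ i, HasLaw (X i) (gaussianReal 0 (v i)) P)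
    (hY : AEStronglyMeasurable Y P) (hv : Tendsto v atTop (𝓝 w))
    (hXY : Tendsto (fun i => eLpNorm (X i - Y) 2 P) atTop (𝓝 0)) :
    HasLaw Y (gaussianReal 0 w) P := by
  have hmeas i : AEStronglyMeasurable (X i) P := (hX i).aemeasurable.aestronglyMeasurable
  have hdist := ((tendstoInMeasure_of_tendsto_eLpNorm two_ne_zero hmeas hY hXY)
    |>.tendstoInDistribution_of_aemeasurable (fun i => (hX i).aemeasurable) hY.aemeasurable).tendsto
  refine ⟨hY.aemeasurable, ?_⟩
  have := Measure.isProbabilityMeasure_map (μ := P) hY.aemeasurable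
  refine Measure.ext_of_charFun (funext fun t => ?_)
  have hchar := ProbabilityMeasure.tendsto_iff_tendsto_charFun.1 hdist t
  simp only [ProbabilityMeasure.coe_mk, (hX _).map_eq, charFun_gaussianReal] at hchar ⊢
  refine tendsto_nhds_unique hchar ((Complex.continuous_exp.tendsto _).comp ?_)
  have hvw : Tendsto (fun i => ((v i : ℝ) : ℂ)) atTop (𝓝 ((w : ℝ) : ℂ)) :=
    ((Complex.continuous_ofReal.comp NNReal.continuous_coe).tendsto w).comp hv
  exact ((hvw.mul_const _).div_const _).const_sub _

end Gaussian

section WienerIntegral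

lemma integrable_toSimpleFunc {m : Measure ℝ} (φ : Lp.simpleFunc ℝ 2 m) :
    Integrable (Lp.simpleFunc.toSimpleFunc φ) m :=
  (SimpleFunc.memLp_iff_integrable two_ne_zero ENNReal.ofNat_ne_top).1 (Lp.simpleFunc.memLp φ)

variable {Ω : Type*} [MeasurableSpace Ω] {P : Measure Ω} {m : Measure ℝ} {B : Set ℝ → Ω → ℝ}

namespace IsGaussianRandomMeasure

lemma isProbabilityMeasure (hB : IsGaussianRandomMeasure B m P) : IsProbabilityMeasure P :=
  (hB.indep (fun _ => ∅) (fun _ => .empty) (by simp) fun _ _ _ => Set.disjoint_empty _)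
    |>.isProbabilityMeasure

lemma memLp (hB : IsGaussianRandomMeasure B m P) {A : Set ℝ} (hA : MeasurableSet A)
    (hmA : m A < ⊤) : MemLp (B A) 2 P :=
  memLp_of_hasLaw_gaussianReal (hB.hasLaw A hA hmA)

lemma ae_eq_zero (hB : IsGaussianRandomMeasure B m P) {A : Set ℝ} (hA : MeasurableSet A)
    (hmA : m A = 0) : B A =ᵐ[P] 0 := by
  have hlaw := hB.hasLaw A hA (by simp [hmA])
  have h := lintegral_sq_of_hasLaw_gaussianReal hlaw
  rw [hmA, ENNReal.toNNReal_zero, ENNReal.coe_zero,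
    lintegral_eq_zero_iff' (hlaw.aemeasurable.enorm.pow_const 2)] at h
  filter_upwards [h] with ω hω
  simpa using hω

lemma union_ae_eq (hB : IsGaussianRandomMeasure B m P) {s t : Set ℝ}
    (hs : MeasurableSet s) (ht : MeasurableSet t) (hms : m s < ⊤) (hmt : m t < ⊤)
    (hst : Disjoint s t) : B (s ∪ t) =ᵐ[P] B s + B t := by
  let A : ℕ → Set ℝ
    | 0 => s
    | 1 => t
    | _ + 2 => ∅
  have hA : ∀ i, MeasurableSet (A i)
    | 0 => hs
    | 1 => ht
    | _ + 2 => .empty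
  have hunion : ⋃ i, A i = s ∪ t := by
    rw [← Set.union_iUnion_nat_succ, ← Set.union_iUnion_nat_succ]
    simp [A]
  have hdisj : Pairwise (Function.onFun Disjoint A) := by
    rintro (_ | _ | i) (_ | _ | j) hij <;> simp_all [Function.onFun, A, disjoint_comm]
  have hmst : m (s ∪ t) < ⊤ := measure_union_lt_top hms hmt
  have hlim := hB.additive A hA (hunion ▸ hmst) hdisj
  rw [hunion] at hlim
  have hconst : ∀ N ≥ 2,
      eLpNorm (fun ω => B (s ∪ t) ω - ∑ i ∈ Finset.range N, B (A i) ω) 2 P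
        = eLpNorm (B (s ∪ t) - (B s + B t)) 2 P := by
    intro N hN
    obtain ⟨M, rfl⟩ := Nat.exists_eq_add_of_le' hN
    refine eLpNorm_congr_ae ?_
    filter_upwards [hB.ae_eq_zero .empty measure_empty] with ω hω
    simp [Finset.sum_range_succ', A, hω, add_comm]
  have hzero := tendsto_nhds_unique hlim (tendsto_const_nhds.congr' <|
    (eventually_ge_atTop 2).mono fun N hN => (hconst N hN).symm)
  have hmem := (hB.memLp (hs.union ht) hmst).sub ((hB.memLp hs hms).add (hB.memLp ht hmt))
  filter_upwards [(eLpNorm_eq_zero_iff hmem.1 two_ne_zero).1 hzero.symm] with ω hω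
  exact sub_eq_zero.1 hω

lemma iIndepFun_of_countable (hB : IsGaussianRandomMeasure B m P) {ι : Type*} [Countable ι]
    {A : ι → Set ℝ} (hA : ∀ i, MeasurableSet (A i)) (hmA : ∀ i, m (A i) < ⊤)
    (hdisj : Pairwise (Function.onFun Disjoint A)) : iIndepFun (fun i => B (A i)) P := by
  have := Encodable.ofCountable ι
  have h := hB.indep (fun n => ⋃ i ∈ Encodable.decode₂ ι n, A i)
    (fun n => Encodable.iUnion_decode₂_cases (C := MeasurableSet) .empty hA)
    (fun n => Encodable.iUnion_decode₂_cases (C := fun s => m s < ⊤) (by simp) hmA)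
    (Encodable.iUnion_decode₂_disjoint_on hdisj)
  simpa [Encodable.encodek₂] using h.precomp (Encodable.encode_injective (α := ι))

open Classical in
/-- The value `B A` as an element of `L²(P)`; junk value `0` unless `A` is a Borel set with
`m A < ∞`. -/
def toLp (hB : IsGaussianRandomMeasure B m P) (A : Set ℝ) : Lp ℝ 2 P :=
  if h : MeasurableSet A ∧ m A < ⊤ then (hB.memLp h.1 h.2).toLp else 0

lemma coeFn_toLp (hB : IsGaussianRandomMeasure B m P) {A : Set ℝ}
    (hA : MeasurableSet A) (hmA : m A < ⊤) : hB.toLp A =ᵐ[P] B A := by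
  rw [toLp, dif_pos ⟨hA, hmA⟩]
  exact MemLp.coeFn_toLp _

/-- The vector measure `B` in the shape expected by `SimpleFunc.setToSimpleFunc`: `A` is sent to
the linear map `c ↦ c • B A`. -/
def toCLM (hB : IsGaussianRandomMeasure B m P) (A : Set ℝ) : ℝ →L[ℝ] Lp ℝ 2 P :=
  ContinuousLinearMap.toSpanSingleton ℝ (hB.toLp A)

lemma toCLM_eq_zero (hB : IsGaussianRandomMeasure B m P) {A : Set ℝ} (hA : MeasurableSet A)
    (hmA : m A = 0) : hB.toCLM A = 0 := by
  have hzero : hB.toLp A = 0 := Lp.ext <| (hB.coeFn_toLp hA (by simp [hmA])).trans <|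
    (hB.ae_eq_zero hA hmA).trans (Lp.coeFn_zero ℝ 2 P).symm
  simp [toCLM, hzero]

lemma finMeasAdditive_toCLM (hB : IsGaussianRandomMeasure B m P) :
    FinMeasAdditive m hB.toCLM := by
  intro s t hs ht hms hmt hst
  have hadd : hB.toLp (s ∪ t) = hB.toLp s + hB.toLp t := by
    refine Lp.ext ?_
    filter_upwards [hB.coeFn_toLp (hs.union ht) (measure_union_lt_top hms.lt_top hmt.lt_top),
      hB.coeFn_toLp hs hms.lt_top, hB.coeFn_toLp ht hmt.lt_top,
      Lp.coeFn_add (hB.toLp s) (hB.toLp t),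
      hB.union_ae_eq hs ht hms.lt_top hmt.lt_top hst] with ω hst hs ht hsum hunion
    rw [hst, hunion, hsum, Pi.add_apply, Pi.add_apply, hs, ht]
  ext1
  simp [toCLM, hadd]

lemma setToSimpleFunc_congr (hB : IsGaussianRandomMeasure B m P) {φ ψ : SimpleFunc ℝ ℝ}
    (hφ : Integrable φ m) (h : φ =ᵐ[m] ψ) :
    φ.setToSimpleFunc hB.toCLM = ψ.setToSimpleFunc hB.toCLM :=
  SimpleFunc.setToSimpleFunc_congr _ (fun _ => hB.toCLM_eq_zero) hB.finMeasAdditive_toCLM hφ h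

lemma coeFn_setToSimpleFunc (hB : IsGaussianRandomMeasure B m P)
    {φ : SimpleFunc ℝ ℝ} (hφ : MemLp φ 2 m) :
    (φ.setToSimpleFunc hB.toCLM : Lp ℝ 2 P) =ᵐ[P] simpleIntegral B φ := by
  have hterm : ∀ c : ℝ, (hB.toCLM (φ ⁻¹' {c}) c : Lp ℝ 2 P) =ᵐ[P] fun ω => c * B (φ ⁻¹' {c}) ω := by
    intro c
    rcases eq_or_ne c 0 with rfl | hc
    · simp only [map_zero, zero_mul]
      exact Lp.coeFn_zero ℝ 2 P
    · filter_upwards [Lp.coeFn_smul c (hB.toLp (φ ⁻¹' {c})),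
        hB.coeFn_toLp (φ.measurableSet_fiber c)
          (SimpleFunc.measure_preimage_lt_top_of_memLp two_ne_zero ENNReal.ofNat_ne_top φ hφ c hc)]
        with ω hsmul hval
      simp [toCLM, hsmul, hval]
  refine (Lp.coeFn_finsetSum _ _).trans ?_
  filter_upwards [(Finset.eventually_all φ.range).2 fun c _ => hterm c] with ω hω
  rw [Finset.sum_apply]
  exact Finset.sum_congr rfl hω

lemma hasLaw_simpleIntegral (hB : IsGaussianRandomMeasure B m P)
    {φ : SimpleFunc ℝ ℝ} (hφ : MemLp φ 2 m) :
    HasLaw (simpleIntegral B φ) (gaussianReal 0 (∫⁻ y, ‖φ y‖ₑ ^ 2 ∂m).toNNReal) P := by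
  let S := φ.range.erase 0
  have hfin (c : S) : m (φ ⁻¹' {(c : ℝ)}) < ⊤ :=
    SimpleFunc.measure_preimage_lt_top_of_memLp two_ne_zero ENNReal.ofNat_ne_top φ hφ c
      (Finset.ne_of_mem_erase c.2)
  have hindep : iIndepFun (fun (c : S) ω => (c : ℝ) * B (φ ⁻¹' {(c : ℝ)}) ω) P :=
    (hB.iIndepFun_of_countable (fun c : S => φ.measurableSet_fiber c) hfin
      ((pairwise_disjoint_fiber φ).comp_of_injective Subtype.val_injective)).comp
      (fun c x => (c : ℝ) * x) (by fun_prop)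
  have hsum : simpleIntegral B φ = ∑ c : S, fun ω => (c : ℝ) * B (φ ⁻¹' {(c : ℝ)}) ω := by
    ext ω
    rw [Finset.sum_apply, Finset.sum_coe_sort S (fun c => c * B (φ ⁻¹' {c}) ω),
      Finset.sum_erase _ (zero_mul _), simpleIntegral]
  have hvar : ∫⁻ y, ‖φ y‖ₑ ^ 2 ∂m = ∑ c : S, ‖(c : ℝ)‖ₑ ^ 2 * m (φ ⁻¹' {(c : ℝ)}) := by
    rw [Finset.sum_coe_sort S (fun c => ‖c‖ₑ ^ 2 * m (φ ⁻¹' {c})),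
      Finset.sum_erase _ (by simp), ← SimpleFunc.map_lintegral, ← SimpleFunc.lintegral_eq_lintegral]
    rfl
  rw [hsum, hvar, ENNReal.toNNReal_sum fun c _ => ENNReal.mul_ne_top (by simp) (hfin c).ne]
  refine hasLaw_sum_gaussianReal hindep (fun c => ?_) Finset.univ
  convert gaussianReal_const_mul (hB.hasLaw _ (φ.measurableSet_fiber c) (hfin c)) (c : ℝ) using 2
  · rw [mul_zero]
  · ext
    simp [ENNReal.toNNReal_mul]

lemma eLpNorm_simpleIntegral (hB : IsGaussianRandomMeasure B m P)
    {φ : SimpleFunc ℝ ℝ} (hφ : MemLp φ 2 m) :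
    eLpNorm (simpleIntegral B φ) 2 P = eLpNorm φ 2 m := by
  refine (ENNReal.pow_right_strictMono two_ne_zero).injective ?_
  rw [sq_eLpNorm_two, lintegral_sq_of_hasLaw_gaussianReal (hB.hasLaw_simpleIntegral hφ),
    ENNReal.coe_toNNReal, sq_eLpNorm_two]
  rw [← sq_eLpNorm_two]
  exact ENNReal.pow_ne_top hφ.2.ne

attribute [local instance] Lp.simpleFunc.module Lp.simpleFunc.normedSpace

/-- The integral of simple functions, as a linear map on the simple functions of `L²(m)`. -/
def simpleIntegralₗ (hB : IsGaussianRandomMeasure B m P) :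
    Lp.simpleFunc ℝ 2 m →ₗ[ℝ] Lp ℝ 2 P where
  toFun φ := (Lp.simpleFunc.toSimpleFunc φ).setToSimpleFunc hB.toCLM
  map_add' φ ψ := by
    rw [← SimpleFunc.setToSimpleFunc_add _ hB.finMeasAdditive_toCLM
      (integrable_toSimpleFunc φ) (integrable_toSimpleFunc ψ)]
    exact hB.setToSimpleFunc_congr (integrable_toSimpleFunc _)
      (Lp.simpleFunc.add_toSimpleFunc φ ψ)
  map_smul' c φ := by
    rw [RingHom.id_apply,
      ← SimpleFunc.setToSimpleFunc_smul_real _ hB.finMeasAdditive_toCLM c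
        (integrable_toSimpleFunc φ)]
    exact hB.setToSimpleFunc_congr (integrable_toSimpleFunc _)
      (Lp.simpleFunc.smul_toSimpleFunc c φ)

lemma coeFn_simpleIntegralₗ (hB : IsGaussianRandomMeasure B m P) (φ : Lp.simpleFunc ℝ 2 m) :
    hB.simpleIntegralₗ φ =ᵐ[P] simpleIntegral B (Lp.simpleFunc.toSimpleFunc φ) :=
  hB.coeFn_setToSimpleFunc (Lp.simpleFunc.memLp φ)

lemma norm_simpleIntegralₗ (hB : IsGaussianRandomMeasure B m P) (φ : Lp.simpleFunc ℝ 2 m) :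
    ‖hB.simpleIntegralₗ φ‖ = ‖φ‖ := by
  rw [Lp.norm_def, eLpNorm_congr_ae (hB.coeFn_simpleIntegralₗ φ),
    hB.eLpNorm_simpleIntegral (Lp.simpleFunc.memLp φ), Lp.simpleFunc.norm_toSimpleFunc]

/-- The Wiener integral `f ↦ ∫ f dB` from `L²(m)` to `L²(P)`, the continuous extension of the
integral of simple functions. -/
def wienerIntegral (hB : IsGaussianRandomMeasure B m P) : Lp ℝ 2 m →L[ℝ] Lp ℝ 2 P :=
  hB.simpleIntegralₗ.extendOfNorm (Lp.simpleFunc.coeToLp ℝ ℝ ℝ).toLinearMap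

lemma wienerIntegral_coe (hB : IsGaussianRandomMeasure B m P) (φ : Lp.simpleFunc ℝ 2 m) :
    hB.wienerIntegral φ = hB.simpleIntegralₗ φ :=
  LinearMap.extendOfNorm_eq (Lp.simpleFunc.denseRange (p := 2) ENNReal.ofNat_ne_top)
    ⟨1, fun ψ => by rw [norm_simpleIntegralₗ, one_mul]; rfl⟩ φ

lemma norm_wienerIntegral (hB : IsGaussianRandomMeasure B m P) (f : Lp ℝ 2 m) :
    ‖hB.wienerIntegral f‖ = ‖f‖ :=
  (Lp.simpleFunc.denseRange (p := 2) ENNReal.ofNat_ne_top).induction_on f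
    (isClosed_eq (by fun_prop) continuous_norm) fun φ => by
      rw [wienerIntegral_coe, norm_simpleIntegralₗ]; rfl

lemma coeFn_wienerIntegral_toLp (hB : IsGaussianRandomMeasure B m P) {φ : SimpleFunc ℝ ℝ}
    (hφ : MemLp φ 2 m) : hB.wienerIntegral hφ.toLp =ᵐ[P] simpleIntegral B φ := by
  have h : hB.wienerIntegral hφ.toLp = φ.setToSimpleFunc hB.toCLM := by
    rw [← Lp.simpleFunc.toLp_eq_toLp, wienerIntegral_coe]
    exact hB.setToSimpleFunc_congr (integrable_toSimpleFunc _)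
      (Lp.simpleFunc.toSimpleFunc_toLp φ hφ)
  rw [h]
  exact hB.coeFn_setToSimpleFunc hφ

lemma tendsto_wienerIntegral (hB : IsGaussianRandomMeasure B m P) {f : ℝ → ℝ}
    (hf : MemLp f 2 m) {φ : ℕ → SimpleFunc ℝ ℝ} (hφ : ∀ i, MemLp (φ i) 2 m)
    (hlim : Tendsto (fun i => eLpNorm (fun y => φ i y - f y) 2 m) atTop (𝓝 0)) :
    Tendsto (fun i => hB.wienerIntegral (hφ i).toLp) atTop (𝓝 (hB.wienerIntegral hf.toLp)) :=
  (hB.wienerIntegral.continuous.tendsto _).comp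
    ((Lp.tendsto_Lp_iff_tendsto_eLpNorm'' (p := 2) (fun i => φ i) hφ f hf).2 hlim)

lemma tendsto_wienerIntegral_iff (hB : IsGaussianRandomMeasure B m P) {Y : Ω → ℝ}
    (hY : MemLp Y 2 P) {φ : ℕ → SimpleFunc ℝ ℝ} (hφ : ∀ i, MemLp (φ i) 2 m) :
    Tendsto (fun i => hB.wienerIntegral (hφ i).toLp) atTop (𝓝 hY.toLp) ↔
      Tendsto (fun i => eLpNorm (fun ω => simpleIntegral B (φ i) ω - Y ω) 2 P) atTop (𝓝 0) := by
  rw [Lp.tendsto_Lp_iff_tendsto_eLpNorm (p := 2) _ Y hY]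
  exact tendsto_congr fun i => eLpNorm_congr_ae <| (hB.coeFn_wienerIntegral_toLp (hφ i)).sub .rfl

end IsGaussianRandomMeasure

lemma isWienerIntegral_iff (hB : IsGaussianRandomMeasure B m P) {f : ℝ → ℝ} {Y : Ω → ℝ} :
    IsWienerIntegral B m P f Y ↔ ∃ hf : MemLp f 2 m, Y =ᵐ[P] hB.wienerIntegral hf.toLp := by
  constructor
  · rintro ⟨hf, hY, φ, hφ, hlim, hlimY⟩
    have heq : hY.toLp = hB.wienerIntegral hf.toLp := tendsto_nhds_unique
      ((hB.tendsto_wienerIntegral_iff hY hφ).2 hlimY) (hB.tendsto_wienerIntegral hf hφ hlim)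
    exact ⟨hf, heq ▸ hY.coeFn_toLp.symm⟩
  · rintro ⟨hf, hYf⟩
    have hY : MemLp Y 2 P := (memLp_congr_ae hYf).2 (Lp.memLp _)
    obtain ⟨u, -, hupos, hu⟩ := exists_seq_strictAnti_tendsto' (zero_lt_one (α := ENNReal))
    choose φ hφlt hφ using fun i => hf.exists_simpleFunc_eLpNorm_sub_lt (p := 2)
      ENNReal.ofNat_ne_top (hupos i).1.ne'
    have hlim : Tendsto (fun i => eLpNorm (fun y => φ i y - f y) 2 m) atTop (𝓝 0) :=
      tendsto_of_tendsto_of_tendsto_of_le_of_le tendsto_const_nhds hu (fun _ => zero_le)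
        fun i => (eLpNorm_sub_comm (φ i) f 2 m).trans_le (hφlt i).le
    refine ⟨hf, hY, φ, hφ, hlim, (hB.tendsto_wienerIntegral_iff hY hφ).1 ?_⟩
    rw [Lp.ext (hY.coeFn_toLp.trans hYf)]
    exact hB.tendsto_wienerIntegral hf hφ hlim

lemma exists_isWienerIntegral (hB : IsGaussianRandomMeasure B m P) {f : ℝ → ℝ}
    (hf : MemLp f 2 m) : ∃ Y : Ω → ℝ, IsWienerIntegral B m P f Y :=
  ⟨_, (isWienerIntegral_iff hB).2 ⟨hf, .rfl⟩⟩

namespace IsWienerIntegral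

lemma congr_ae {f : ℝ → ℝ} {Y Y' : Ω → ℝ} (h : IsWienerIntegral B m P f Y) (hY : Y =ᵐ[P] Y') :
    IsWienerIntegral B m P f Y' := by
  obtain ⟨hf, hfY, φ, hφ, hlim, hlimY⟩ := h
  refine ⟨hf, hfY.ae_eq hY, φ, hφ, hlim, hlimY.congr fun i => eLpNorm_congr_ae ?_⟩
  exact EventuallyEq.rfl.sub hY

lemma sum (hB : IsGaussianRandomMeasure B m P) {ι : Type*} (s : Finset ι) {f : ι → ℝ → ℝ}
    {Y : ι → Ω → ℝ} (h : ∀ i ∈ s, IsWienerIntegral B m P (f i) (Y i)) (c : ι → ℝ) :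
    IsWienerIntegral B m P (∑ i ∈ s, c i • f i) (∑ i ∈ s, c i • Y i) := by
  classical
  induction s using Finset.induction_on with
  | empty =>
    refine (isWienerIntegral_iff hB).2 ⟨MemLp.zero, ?_⟩
    simpa using (Lp.coeFn_zero ℝ 2 P).symm
  | insert i s hi ih =>
    rw [Finset.forall_mem_insert] at h
    obtain ⟨hf, hY⟩ := (isWienerIntegral_iff hB).1 h.1
    obtain ⟨hg, hW⟩ := (isWienerIntegral_iff hB).1 (ih h.2)
    rw [Finset.sum_insert hi, Finset.sum_insert hi]
    refine (isWienerIntegral_iff hB).2 ⟨(hf.const_smul (c i)).add hg, ?_⟩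
    rw [MemLp.toLp_add (hf.const_smul (c i)) hg, MemLp.toLp_const_smul (c i) hf, map_add, map_smul]
    exact ((hY.const_smul (c i)).trans (Lp.coeFn_smul _ _).symm).add hW |>.trans
      (Lp.coeFn_add _ _).symm

lemma sub (hB : IsGaussianRandomMeasure B m P) {f g : ℝ → ℝ} {Y W : Ω → ℝ}
    (h : IsWienerIntegral B m P f Y) (h' : IsWienerIntegral B m P g W) :
    IsWienerIntegral B m P (f - g) (Y - W) := by
  obtain ⟨hf, hY⟩ := (isWienerIntegral_iff hB).1 h
  obtain ⟨hg, hW⟩ := (isWienerIntegral_iff hB).1 h'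
  refine (isWienerIntegral_iff hB).2 ⟨hf.sub hg, ?_⟩
  rw [MemLp.toLp_sub hf hg, map_sub]
  exact (hY.sub hW).trans (Lp.coeFn_sub _ _).symm

lemma eLpNorm_eq (hB : IsGaussianRandomMeasure B m P) {f : ℝ → ℝ} {Y : Ω → ℝ}
    (h : IsWienerIntegral B m P f Y) : eLpNorm Y 2 P = eLpNorm f 2 m := by
  obtain ⟨hf, hY⟩ := (isWienerIntegral_iff hB).1 h
  rw [eLpNorm_congr_ae hY, ← eLpNorm_congr_ae hf.coeFn_toLp]
  exact (ENNReal.toReal_eq_toReal_iff' (Lp.eLpNorm_ne_top _) (Lp.eLpNorm_ne_top _)).1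
    (hB.norm_wienerIntegral hf.toLp)

lemma hasLaw (hB : IsGaussianRandomMeasure B m P) {f : ℝ → ℝ} {Y : Ω → ℝ}
    (h : IsWienerIntegral B m P f Y) :
    HasLaw Y (gaussianReal 0 (∫⁻ y, ‖f y‖ₑ ^ 2 ∂m).toNNReal) P := by
  have := hB.isProbabilityMeasure
  obtain ⟨hf, hY, φ, hφ, hlim, hlimY⟩ := h
  refine hasLaw_gaussianReal_of_tendsto_eLpNorm (fun i => hB.hasLaw_simpleIntegral (hφ i)) hY.1 ?_
    hlimY
  have hnorm := (((Lp.tendsto_Lp_iff_tendsto_eLpNorm'' (p := 2) (fun i => φ i) hφ f hf).2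
    hlim).norm).pow 2
  simp only [← sq_eLpNorm_two]
  refine NNReal.tendsto_coe.1 ?_
  simpa only [Lp.norm_toLp, ENNReal.coe_toNNReal_eq_toReal, ENNReal.toReal_pow] using hnorm

end IsWienerIntegral

end WienerIntegral

/-! ### Weighted sums of i.i.d. variables -/

section WeightedSum

open scoped NNReal ENNReal

/-- The characteristic function of the centred Gaussian law with variance `v`, for a real `v`. -/
def gaussianCharFun (v u : ℝ) : ℂ :=
  Complex.exp (-(v * u ^ 2 / 2 : ℝ))

lemma charFun_gaussianReal_zero (v : ℝ≥0) (u : ℝ) :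
    charFun (gaussianReal 0 v) u = gaussianCharFun v u := by
  rw [charFun_gaussianReal, gaussianCharFun]
  congr 1
  push_cast
  ring

lemma norm_gaussianCharFun_le_one {v : ℝ} (hv : 0 ≤ v) (u : ℝ) : ‖gaussianCharFun v u‖ ≤ 1 := by
  lift v to ℝ≥0 using hv
  exact charFun_gaussianReal_zero v u ▸ norm_charFun_le_one u

lemma continuous_gaussianCharFun_left (u : ℝ) : Continuous fun v => gaussianCharFun v u := by
  unfold gaussianCharFun
  fun_prop

lemma prod_gaussianCharFun {ι : Type*} (s : Finset ι) (v : ℝ) (w : ι → ℝ) (u : ℝ) :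
    ∏ i ∈ s, gaussianCharFun v (w i * u) = gaussianCharFun (v * ∑ i ∈ s, w i ^ 2) u := by
  simp only [gaussianCharFun, ← Complex.exp_sum, ← Complex.ofReal_neg, ← Complex.ofReal_sum]
  rw [Finset.sum_neg_distrib, Finset.mul_sum, Finset.sum_mul, Finset.sum_div]
  simp only [mul_pow, mul_assoc]

lemma norm_prod_sub_prod_le_sum {ι : Type*} (s : Finset ι) (a b : ι → ℂ)
    (ha : ∀ i ∈ s, ‖a i‖ ≤ 1) (hb : ∀ i ∈ s, ‖b i‖ ≤ 1) :
    ‖∏ i ∈ s, a i - ∏ i ∈ s, b i‖ ≤ ∑ i ∈ s, ‖a i - b i‖ := by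
  classical
  induction s using Finset.induction_on with
  | empty => simp
  | insert j s hj ih =>
    rw [Finset.forall_mem_insert] at ha hb
    rw [Finset.prod_insert hj, Finset.prod_insert hj, Finset.sum_insert hj]
    have hprod : ‖∏ i ∈ s, a i‖ ≤ 1 := by
      rw [norm_prod]
      exact Finset.prod_le_one (fun _ _ => norm_nonneg _) ha.2
    calc ‖a j * ∏ i ∈ s, a i - b j * ∏ i ∈ s, b i‖
        = ‖(a j - b j) * ∏ i ∈ s, a i + b j * (∏ i ∈ s, a i - ∏ i ∈ s, b i)‖ := by
          congr 1; ring
      _ ≤ ‖a j - b j‖ * ‖∏ i ∈ s, a i‖ + ‖b j‖ * ‖∏ i ∈ s, a i - ∏ i ∈ s, b i‖ := by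
          rw [← norm_mul, ← norm_mul]; exact norm_add_le _ _
      _ ≤ ‖a j - b j‖ * 1 + 1 * ∑ i ∈ s, ‖a i - b i‖ := by
          gcongr
          exacts [hb.1, ih ha.2 hb.2]
      _ = _ := by ring

lemma hasSum_sq_of_tsum_enorm_ne_top {ι : Type*} {w : ι → ℝ} (h : ∑' i, ‖w i‖ₑ ^ 2 ≠ ⊤) :
    HasSum (fun i => w i ^ 2) (∑' i, ‖w i‖ₑ ^ 2).toReal := by
  rw [ENNReal.tsum_toReal_eq fun i => ENNReal.pow_ne_top enorm_ne_top]
  simpa using ENNReal.hasSum_toReal h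

variable {Ω : Type*} [MeasurableSpace Ω] {P : Measure Ω} {ι : Type*}

lemma charFun_taylor_isLittleO [IsProbabilityMeasure P] {X : Ω → ℝ} (hX : MemLp X 2 P)
    (hmean : ∫ ω, X ω ∂P = 0) :
    (fun u : ℝ => charFun (P.map X) u - (1 - (Var[X; P] * u ^ 2 / 2 : ℝ)))
      =o[𝓝 0] fun u : ℝ => u ^ 2 := by
  have hmeas := hX.1.aemeasurable
  have hmem : MemLp id 2 (P.map X) := (memLp_map_measure_iff aestronglyMeasurable_id hmeas).2 hX
  have := Measure.isProbabilityMeasure_map hmeas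
  have hpoly (u : ℝ) : taylorWithinEval (charFun (P.map X)) 2 Set.univ 0 u
      = 1 - (Var[X; P] * u ^ 2 / 2 : ℝ) := by
    rw [taylorWithinEval_charFun_two_zero hmeas hmem, hmean,
      variance_of_integral_eq_zero hmeas hmean]
    simp only [Pi.pow_apply]
    push_cast
    ring
  simpa only [hpoly, sub_zero] using
    taylor_isLittleO_univ (x₀ := 0) (n := 2) (contDiff_charFun (n := 2) hmem)

lemma charFun_sub_gaussianCharFun_isLittleO [IsProbabilityMeasure P] {X : Ω → ℝ}
    (hX : MemLp X 2 P) (hmean : ∫ ω, X ω ∂P = 0) :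
    (fun u => charFun (P.map X) u - gaussianCharFun Var[X; P] u) =o[𝓝 0] fun u => u ^ 2 := by
  have hgauss := charFun_taylor_isLittleO (P := gaussianReal 0 Var[X; P].toNNReal)
    (memLp_id_gaussianReal' 2 ENNReal.ofNat_ne_top) integral_id_gaussianReal
  rw [variance_id_gaussianReal, Measure.map_id] at hgauss
  simp only [charFun_gaussianReal_zero, Real.coe_toNNReal _ (variance_nonneg X P)] at hgauss
  exact ((charFun_taylor_isLittleO hX hmean).sub hgauss).congr_left fun u => by ring

lemma tendsto_charFun_of_ae_tendsto [IsProbabilityMeasure P] {X : ℕ → Ω → ℝ} {W : Ω → ℝ}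
    (hX : ∀ n, AEMeasurable (X n) P)
    (h : ∀ᵐ ω ∂P, Tendsto (fun n => X n ω) atTop (𝓝 (W ω))) (u : ℝ) :
    Tendsto (fun n => charFun (P.map (X n)) u) atTop (𝓝 (charFun (P.map W) u)) :=
  ProbabilityMeasure.tendsto_iff_tendsto_charFun.1 (tendstoInDistribution_of_ae_tendsto hX
    (aemeasurable_of_tendsto_metrizable_ae' hX h) h).tendsto u

lemma aemeasurable_of_ae_hasSum [Countable ι] {f : ι → Ω → ℝ} {W : Ω → ℝ}
    (hf : ∀ i, AEMeasurable (f i) P) (hW : ∀ᵐ ω ∂P, HasSum (fun i => f i ω) (W ω)) :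
    AEMeasurable W P :=
  aemeasurable_of_tendsto_metrizable_ae atTop
    (fun s => Finset.aemeasurable_fun_sum s fun i _ => hf i) hW

lemma sq_eLpNorm_le_of_ae_tendsto {X : ℕ → Ω → ℝ} {W : Ω → ℝ} {C : ℝ≥0∞}
    (hX : ∀ n, AEStronglyMeasurable (X n) P) (hC : ∀ n, eLpNorm (X n) 2 P ^ 2 ≤ C)
    (h : ∀ᵐ ω ∂P, Tendsto (fun n => X n ω) atTop (𝓝 (W ω))) : eLpNorm W 2 P ^ 2 ≤ C := by
  have hsq (x : ℝ≥0∞) : x ^ 2 ≤ C ↔ x ≤ C ^ (2 : ℝ)⁻¹ := by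
    rw [ENNReal.le_rpow_inv_iff two_pos, ENNReal.rpow_ofNat]
  simp only [hsq] at hC ⊢
  exact (Lp.eLpNorm_lim_le_liminf_eLpNorm hX W h).trans
    ((liminf_le_liminf (Eventually.of_forall hC)).trans_eq (liminf_const _))

lemma ae_summable_abs [Countable ι] {f : ι → Ω → ℝ} (hf : ∀ i, AEMeasurable (f i) P)
    (hsum : ∑' i, ∫⁻ ω, ‖f i ω‖ₑ ∂P ≠ ⊤) : ∀ᵐ ω ∂P, Summable fun i => |f i ω| := by
  rw [← lintegral_tsum fun i => (hf i).enorm] at hsum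
  filter_upwards [ae_lt_top' (AEMeasurable.tsum fun i => (hf i).enorm) hsum] with ω hω
  simpa using ENNReal.summable_toReal hω.ne

variable {Z : ι → Ω → ℝ} {X : Ω → ℝ}

lemma ae_summable_abs_weighted [Countable ι] (hident : ∀ i, IdentDistrib (Z i) X P P)
    (hX : Integrable X P) {w : ι → ℝ} (hw : Summable fun i => |w i|) :
    ∀ᵐ ω ∂P, Summable fun i => |w i * Z i ω| := by
  have hZ i : AEMeasurable (Z i) P := (hident i).aemeasurable_fst
  have hterm i : ∫⁻ ω, ‖w i * Z i ω‖ₑ ∂P = ENNReal.ofReal |w i| * ∫⁻ ω, ‖X ω‖ₑ ∂P := by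
    simp only [enorm_mul, ← Real.enorm_eq_ofReal_abs]
    rw [lintegral_const_mul'' _ (hZ i).enorm]
    exact congrArg _ ((hident i).comp measurable_enorm).lintegral_eq
  refine ae_summable_abs (fun i => (hZ i).const_mul (w i)) ?_
  simp only [hterm, ENNReal.tsum_mul_right]
  exact ENNReal.mul_ne_top hw.tsum_ofReal_ne_top hX.2.ne

lemma charFun_finset_weighted_sum (hindep : iIndepFun Z P)
    (hident : ∀ i, IdentDistrib (Z i) X P P) (w : ι → ℝ) (s : Finset ι) (u : ℝ) :
    charFun (P.map fun ω => ∑ i ∈ s, w i * Z i ω) u = ∏ i ∈ s, charFun (P.map X) (w i * u) := by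
  have hZ i : AEMeasurable (Z i) P := (hident i).aemeasurable_fst
  have hindepw : iIndepFun (fun i ω => w i * Z i ω) P :=
    hindep.comp (fun i x => w i * x) (by fun_prop)
  rw [(hindepw.restrict s).charFun_map_fun_finsetSum_eq_prod fun i _ => (hZ i).const_mul _,
    Finset.prod_apply]
  refine Finset.prod_congr rfl fun i _ => ?_
  rw [charFun_map_mul_comp (hZ i), (hident i).map_eq]

lemma norm_charFun_finset_weighted_sum_sub_le [IsProbabilityMeasure P] (hindep : iIndepFun Z P)
    (hident : ∀ i, IdentDistrib (Z i) X P P) (hX : AEMeasurable X P) {w : ι → ℝ} (u : ℝ)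
    {v ε δ : ℝ} (hv : 0 ≤ v)
    (hδ : ∀ x, |x| ≤ δ → ‖charFun (P.map X) x - gaussianCharFun v x‖ ≤ ε * x ^ 2)
    (hwδ : ∀ i, |w i * u| ≤ δ) (s : Finset ι) :
    ‖charFun (P.map fun ω => ∑ i ∈ s, w i * Z i ω) u - gaussianCharFun (v * ∑ i ∈ s, w i ^ 2) u‖
      ≤ ε * u ^ 2 * ∑ i ∈ s, w i ^ 2 := by
  have := Measure.isProbabilityMeasure_map hX
  rw [charFun_finset_weighted_sum hindep hident, ← prod_gaussianCharFun, Finset.mul_sum]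
  refine (norm_prod_sub_prod_le_sum s _ _ (fun i _ => norm_charFun_le_one _)
    fun i _ => norm_gaussianCharFun_le_one hv _).trans (Finset.sum_le_sum fun i _ => ?_)
  exact (hδ _ (hwδ i)).trans_eq (by ring)

lemma norm_charFun_weighted_sum_sub_le [Countable ι] [IsProbabilityMeasure P]
    (hindep : iIndepFun Z P) (hident : ∀ i, IdentDistrib (Z i) X P P) (hX : AEMeasurable X P)
    {w : ι → ℝ} {q : ℝ} {W : Ω → ℝ} (hq : HasSum (fun i => w i ^ 2) q)
    (hW : ∀ᵐ ω ∂P, HasSum (fun i => w i * Z i ω) (W ω)) (u : ℝ) {v ε δ : ℝ} (hv : 0 ≤ v)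
    (hδ : ∀ x, |x| ≤ δ → ‖charFun (P.map X) x - gaussianCharFun v x‖ ≤ ε * x ^ 2)
    (hwδ : ∀ i, |w i * u| ≤ δ) :
    ‖charFun (P.map W) u - gaussianCharFun (v * q) u‖ ≤ ε * u ^ 2 * q := by
  obtain ⟨S, hS⟩ := exists_seq_tendsto (atTop : Filter (Finset ι))
  have hchar : Tendsto (fun n => charFun (P.map fun ω => ∑ i ∈ S n, w i * Z i ω) u) atTop
      (𝓝 (charFun (P.map W) u)) := by
    refine tendsto_charFun_of_ae_tendsto (fun n => Finset.aemeasurable_fun_sum _ fun i _ =>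
      (hident i).aemeasurable_fst.const_mul _) ?_ u
    filter_upwards [hW] with ω hω using hω.comp hS
  have hsum : Tendsto (fun n => ∑ i ∈ S n, w i ^ 2) atTop (𝓝 q) := hq.comp hS
  have hgauss := ((continuous_gaussianCharFun_left u).tendsto _).comp (hsum.const_mul v)
  exact le_of_tendsto_of_tendsto' (hchar.sub hgauss).norm (hsum.const_mul _) fun n =>
    norm_charFun_finset_weighted_sum_sub_le hindep hident hX u hv hδ hwδ (S n)

theorem tendsto_charFun_weighted_sum [Countable ι] [IsProbabilityMeasure P]
    (hindep : iIndepFun Z P) (hident : ∀ i, IdentDistrib (Z i) X P P) (hX : MemLp X 2 P)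
    (hmean : ∫ ω, X ω ∂P = 0) {w : ℕ → ι → ℝ} {W : ℕ → Ω → ℝ} {b : ℕ → ℝ} {q : ℝ≥0∞}
    (hW : ∀ᶠ n in atTop, ∀ᵐ ω ∂P, HasSum (fun i => w n i * Z i ω) (W n ω))
    (hb : ∀ᶠ n in atTop, ∀ i, |w n i| ≤ b n) (hb0 : Tendsto b atTop (𝓝 0)) (hq : q ≠ ⊤)
    (hwq : Tendsto (fun n => ∑' i, ‖w n i‖ₑ ^ 2) atTop (𝓝 q)) (u : ℝ) :
    Tendsto (fun n => charFun (P.map (W n)) u) atTop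
      (𝓝 (gaussianCharFun (Var[X; P] * q.toReal) u)) := by
  have hwq' := (ENNReal.tendsto_toReal hq).comp hwq
  have hgauss := ((continuous_gaussianCharFun_left u).tendsto _).comp (hwq'.const_mul Var[X; P])
  suffices hdiff : Tendsto (fun n => charFun (P.map (W n)) u -
      gaussianCharFun (Var[X; P] * (∑' i, ‖w n i‖ₑ ^ 2).toReal) u) atTop (𝓝 0) by
    simpa using hdiff.add hgauss
  rw [Metric.tendsto_nhds]
  intro η hη
  set ε := η / (u ^ 2 * (q.toReal + 1) + 1) with hε
  have hε0 : 0 < ε := by positivity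
  obtain ⟨δ, hδ0, hδ⟩ := Metric.nhds_basis_closedBall.eventually_iff.1
    ((charFun_sub_gaussianCharFun_isLittleO hX hmean).def hε0)
  have hbu : Tendsto (fun n => b n * |u|) atTop (𝓝 0) := by simpa using hb0.mul_const |u|
  filter_upwards [hW, hb, hbu.eventually_le_const hδ0, hwq.eventually_lt_const hq.lt_top,
    hwq'.eventually_le_const (lt_add_one _)] with n hWn hbn hbun hqn hqn'
  rw [dist_zero_right]
  calc _ ≤ ε * u ^ 2 * (∑' i, ‖w n i‖ₑ ^ 2).toReal :=
        norm_charFun_weighted_sum_sub_le hindep hident hX.1.aemeasurable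
          (hasSum_sq_of_tsum_enorm_ne_top hqn.ne) hWn u (variance_nonneg X P)
          (fun x hx => by simpa using hδ (mem_closedBall_zero_iff.2 hx))
          fun i => (abs_mul _ _).trans_le
            ((mul_le_mul_of_nonneg_right (hbn i) (abs_nonneg u)).trans hbun)
    _ ≤ ε * u ^ 2 * (q.toReal + 1) := by gcongr; exact hqn'
    _ < ε * (u ^ 2 * (q.toReal + 1) + 1) := by linarith
    _ = η := by rw [hε]; field_simp

lemma sq_eLpNorm_finset_weighted_sum [IsProbabilityMeasure P] (hindep : iIndepFun Z P)
    (hident : ∀ i, IdentDistrib (Z i) X P P) (hX : MemLp X 2 P) (hmean : ∫ ω, X ω ∂P = 0)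
    (w : ι → ℝ) (s : Finset ι) :
    eLpNorm (∑ i ∈ s, fun ω => w i * Z i ω) 2 P ^ 2
      = ENNReal.ofReal Var[X; P] * ∑ i ∈ s, ‖w i‖ₑ ^ 2 := by
  have hmem i : MemLp (fun ω => w i * Z i ω) 2 P := ((hident i).memLp_iff.2 hX).const_mul (w i)
  have hmems : MemLp (∑ i ∈ s, fun ω => w i * Z i ω) 2 P := memLp_finsetSum' s fun i _ => hmem i
  have hindepw : iIndepFun (fun i ω => w i * Z i ω) P :=
    hindep.comp (fun i x => w i * x) (by fun_prop)
  have hmeans : ∫ ω, (∑ i ∈ s, fun ω => w i * Z i ω) ω ∂P = 0 := by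
    simp only [Finset.sum_apply]
    rw [integral_finsetSum _ fun i _ => (hmem i).integrable one_le_two]
    simp [integral_const_mul, (hident _).integral_eq, hmean]
  have hvar : Var[∑ i ∈ s, fun ω => w i * Z i ω; P] = Var[X; P] * ∑ i ∈ s, w i ^ 2 := by
    rw [IndepFun.variance_sum (fun i _ => hmem i) fun i _ j _ hij => hindepw.indepFun hij,
      Finset.mul_sum]
    refine Finset.sum_congr rfl fun i _ => ?_
    rw [variance_const_mul, (hident i).variance_eq, mul_comm]
  rw [variance_of_integral_eq_zero hmems.1.aemeasurable hmeans] at hvar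
  simp only [sq_eLpNorm_two, enorm_sq_eq_ofReal]
  rw [← ENNReal.ofReal_sum_of_nonneg fun i _ => sq_nonneg (w i),
    ← ENNReal.ofReal_mul (variance_nonneg X P), ← hvar]
  exact (ofReal_integral_eq_lintegral_ofReal hmems.integrable_sq
    (ae_of_all _ fun ω => sq_nonneg _)).symm

lemma sq_eLpNorm_weighted_sum_le [Countable ι] [IsProbabilityMeasure P] (hindep : iIndepFun Z P)
    (hident : ∀ i, IdentDistrib (Z i) X P P) (hX : MemLp X 2 P) (hmean : ∫ ω, X ω ∂P = 0)
    {w : ι → ℝ} {W : Ω → ℝ} (hW : ∀ᵐ ω ∂P, HasSum (fun i => w i * Z i ω) (W ω)) :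
    eLpNorm W 2 P ^ 2 ≤ ENNReal.ofReal Var[X; P] * ∑' i, ‖w i‖ₑ ^ 2 := by
  obtain ⟨S, hS⟩ := exists_seq_tendsto (atTop : Filter (Finset ι))
  refine sq_eLpNorm_le_of_ae_tendsto (X := fun n => ∑ i ∈ S n, fun ω => w i * Z i ω)
    (fun n => (memLp_finsetSum' (S n) fun i _ =>
      ((hident i).memLp_iff.2 hX).const_mul (w i)).1) (fun n => ?_) ?_
  · rw [sq_eLpNorm_finset_weighted_sum hindep hident hX hmean]
    gcongr
    exact ENNReal.sum_le_tsum _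
  · filter_upwards [hW] with ω hω
    simpa only [Finset.sum_apply, Function.comp_def] using hω.comp hS

end WeightedSum

/-! ### Dyadic interpolation in `C[0,1]` -/

section DyadicInterpolation

/-- The dyadic point `k / 2 ^ m`, truncated to the unit interval so as to be defined for all `k`. -/
def node (m k : ℕ) : unitInterval := Set.projIcc 0 1 zero_le_one ((k : ℝ) / 2 ^ m)

/-- The hat function of level `m` centred at `k / 2 ^ m`. -/
def hat (m k : ℕ) : C(unitInterval, ℝ) where
  toFun t := max 0 (1 - |2 ^ m * (t : ℝ) - k|)
  continuous_toFun := by fun_prop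

/-- The polygonal function that agrees with `x` at the dyadic points of level `m`. -/
def dyadicInterp (m : ℕ) (x : unitInterval → ℝ) : C(unitInterval, ℝ) :=
  ∑ k ∈ Finset.range (2 ^ m + 1), x (node m k) • hat m k

lemma node_succ_two_mul (m k : ℕ) : node (m + 1) (2 * k) = node m k := by
  unfold node
  congr 1
  push_cast
  rw [pow_succ]
  field_simp

lemma edist_le_inv_two_pow {m : ℕ} {s t : unitInterval} (h : dist s t ≤ (2 ^ m)⁻¹) :
    edist s t ≤ 2⁻¹ ^ m := by
  rw [edist_dist]
  refine (ENNReal.ofReal_le_ofReal h).trans_eq ?_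
  rw [ENNReal.ofReal_inv_of_pos (by positivity), ENNReal.ofReal_pow zero_le_two,
    ENNReal.ofReal_ofNat, ENNReal.inv_pow]

lemma edist_node_succ_le (m k : ℕ) : edist (node m k) (node m (k + 1)) ≤ 2⁻¹ ^ m := by
  refine edist_le_inv_two_pow ((Set.abs_projIcc_sub_projIcc zero_le_one).trans_eq ?_)
  push_cast
  rw [← sub_div, sub_add_cancel_left, abs_div, abs_neg, abs_one, abs_of_pos (by positivity),
    one_div]

lemma hat_nonneg (m k : ℕ) (t : unitInterval) : 0 ≤ hat m k t := le_max_left _ _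

lemma abs_sub_lt_one_of_hat_ne_zero {m k : ℕ} {t : unitInterval} (h : hat m k t ≠ 0) :
    |2 ^ m * (t : ℝ) - k| < 1 := by
  by_contra! hle
  exact h (max_eq_left (sub_nonpos.2 hle))

lemma dist_node_le_of_hat_ne_zero {m k : ℕ} {t : unitInterval} (h : hat m k t ≠ 0) :
    dist (node m k) t ≤ (2 ^ m)⁻¹ := by
  have hlt := abs_sub_lt_one_of_hat_ne_zero h
  have hcontr : |(node m k : ℝ) - t| ≤ |(k : ℝ) / 2 ^ m - t| := by
    conv_lhs => rw [show t = Set.projIcc 0 1 zero_le_one (t : ℝ) from (Set.projIcc_val _ t).symm]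
    exact Set.abs_projIcc_sub_projIcc zero_le_one
  have hdiv : (k : ℝ) / 2 ^ m - t = (k - 2 ^ m * t) / 2 ^ m := by field_simp
  rw [Subtype.dist_eq, Real.dist_eq]
  refine hcontr.trans ?_
  rw [hdiv, abs_div, abs_of_pos (by positivity : (0 : ℝ) < 2 ^ m), abs_sub_comm, ← one_div]
  gcongr

lemma sum_range_max_zero_one_sub_abs (N : ℕ) {u : ℝ} (h0 : 0 ≤ u) (hu : u ≤ N) :
    ∑ k ∈ Finset.range (N + 1), max 0 (1 - |u - k|) = 1 := by
  induction N with
  | zero =>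
    obtain rfl : u = 0 := le_antisymm (by simpa using hu) h0
    simp
  | succ N ih =>
    rcases le_total u N with h | h
    · have hlast : max 0 (1 - |u - (N + 1 : ℕ)|) = 0 :=
        max_eq_left (by rw [abs_sub_comm]; push_cast; linarith [le_abs_self ((N : ℝ) + 1 - u)])
      rw [Finset.sum_range_succ, ih h, hlast, add_zero]
    · have hfirst : ∑ k ∈ Finset.range N, max 0 (1 - |u - k|) = 0 := by
        refine Finset.sum_eq_zero fun k hk => max_eq_left ?_
        have : (k : ℝ) + 1 ≤ N := by exact_mod_cast Finset.mem_range.1 hk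
        linarith [le_abs_self (u - k)]
      push_cast at hu
      rw [Finset.sum_range_succ, Finset.sum_range_succ, hfirst]
      push_cast
      rw [abs_of_nonneg (by linarith), abs_of_nonpos (by linarith), max_eq_right (by linarith),
        max_eq_right (by linarith)]
      ring

lemma sum_hat (m : ℕ) (t : unitInterval) : ∑ k ∈ Finset.range (2 ^ m + 1), hat m k t = 1 := by
  refine sum_range_max_zero_one_sub_abs (2 ^ m) (mul_nonneg (by positivity) t.2.1) ?_
  push_cast
  exact mul_le_of_le_one_right (by positivity) t.2.2

lemma dyadicInterp_sub_apply (m : ℕ) (x : unitInterval → ℝ) (t : unitInterval) (c : ℝ) :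
    dyadicInterp m x t - c = ∑ k ∈ Finset.range (2 ^ m + 1), hat m k t * (x (node m k) - c) := by
  simp only [dyadicInterp, ContinuousMap.sum_apply, ContinuousMap.smul_apply, smul_eq_mul, mul_sub,
    Finset.sum_sub_distrib, ← Finset.sum_mul, sum_hat, one_mul]
  simp only [mul_comm]

lemma abs_dyadicInterp_sub_le {m : ℕ} {x : unitInterval → ℝ} {t : unitInterval} {c r : ℝ}
    (h : ∀ k ≤ 2 ^ m, hat m k t ≠ 0 → |x (node m k) - c| ≤ r) :
    |dyadicInterp m x t - c| ≤ r := by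
  rw [dyadicInterp_sub_apply]
  calc |∑ k ∈ Finset.range (2 ^ m + 1), hat m k t * (x (node m k) - c)|
      ≤ ∑ k ∈ Finset.range (2 ^ m + 1), |hat m k t * (x (node m k) - c)| :=
        Finset.abs_sum_le_sum_abs _ _
    _ ≤ ∑ k ∈ Finset.range (2 ^ m + 1), hat m k t * r := by
        refine Finset.sum_le_sum fun k hk => ?_
        rw [abs_mul, abs_of_nonneg (hat_nonneg m k t)]
        by_cases hk0 : hat m k t = 0
        · simp [hk0]
        · exact mul_le_mul_of_nonneg_left (h k (Finset.mem_range_succ_iff.1 hk) hk0)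
            (hat_nonneg m k t)
    _ = r := by rw [← Finset.sum_mul, sum_hat, one_mul]

lemma tendsto_dyadicInterp (x : C(unitInterval, ℝ)) :
    Tendsto (fun m => dyadicInterp m x) atTop (𝓝 x) := by
  rw [Metric.tendsto_atTop']
  intro ε hε
  obtain ⟨δ, hδ, hx⟩ := Metric.uniformContinuous_iff.1
    (CompactSpace.uniformContinuous_of_continuous x.continuous) (ε / 2) (half_pos hε)
  obtain ⟨N, hN⟩ := exists_pow_lt_of_lt_one hδ (by norm_num : (2⁻¹ : ℝ) < 1)
  refine ⟨N, fun m hm => lt_of_le_of_lt ?_ (half_lt_self hε)⟩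
  refine (ContinuousMap.dist_le (half_pos hε).le).2 fun t => ?_
  refine abs_dyadicInterp_sub_le fun k _ hk => (hx ?_).le
  calc dist (node m k) t ≤ (2 ^ m)⁻¹ := dist_node_le_of_hat_ne_zero hk
    _ = 2⁻¹ ^ m := (inv_pow _ _).symm
    _ ≤ 2⁻¹ ^ N := pow_le_pow_of_le_one (by norm_num) (by norm_num) (le_of_lt hm)
    _ < δ := hN

lemma dist_node_le_two_mul {R : ℝ} {m : ℕ} {x : unitInterval → ℝ}
    (hR : ∀ k < 2 ^ m, dist (x (node m k)) (x (node m (k + 1))) ≤ R) {i j : ℕ} (hij : i ≤ j)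
    (hji : j ≤ i + 2) (hj : j ≤ 2 ^ m) : dist (x (node m i)) (x (node m j)) ≤ 2 * R := by
  rcases hij.eq_or_lt with rfl | hlt
  · have : 0 ≤ R := dist_nonneg.trans (hR 0 (by positivity))
    simpa
  have hR0 : 0 ≤ R := dist_nonneg.trans (hR i (by omega))
  calc dist (x (node m i)) (x (node m j))
      ≤ ∑ _k ∈ Finset.Ico i j, R :=
        dist_le_Ico_sum_of_dist_le (f := fun k => x (node m k)) hij fun _ hk => hR _ (by omega)
    _ = ((j - i : ℕ) : ℝ) * R := by simp
    _ ≤ 2 * R := by gcongr; exact_mod_cast (by omega : j - i ≤ 2)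

lemma dist_dyadicInterp_succ_le {R : ℝ} {m : ℕ} {x : unitInterval → ℝ}
    (hR : ∀ k < 2 ^ (m + 1), dist (x (node (m + 1) k)) (x (node (m + 1) (k + 1))) ≤ R) :
    dist (dyadicInterp m x) (dyadicInterp (m + 1) x) ≤ 2 * R := by
  have hR0 : 0 ≤ R := dist_nonneg.trans (hR 0 (by positivity))
  refine (ContinuousMap.dist_le (by positivity)).2 fun t => ?_
  refine abs_dyadicInterp_sub_le fun i hi hit => ?_
  rw [abs_sub_comm]
  refine abs_dyadicInterp_sub_le fun j hj hjt => ?_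
  have hi1 := abs_lt.1 (abs_sub_lt_one_of_hat_ne_zero hit)
  have hj1 := abs_lt.1 (abs_sub_lt_one_of_hat_ne_zero hjt)
  rw [pow_succ'] at hj hj1
  have h1 : j < 2 * i + 3 := by
    rify
    linarith
  have h2 : 2 * i < j + 3 := by
    rify
    linarith
  rw [← node_succ_two_mul m i, ← Real.dist_eq]
  rcases le_total j (2 * i) with h | h
  · exact dist_node_le_two_mul hR h (by omega) (by rw [pow_succ']; omega)
  · rw [dist_comm]
    exact dist_node_le_two_mul hR h (by omega) (by rwa [pow_succ'])

lemma sq_edist_dyadicInterp_succ_le (m : ℕ) (x : unitInterval → ℝ) :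
    edist (dyadicInterp m x) (dyadicInterp (m + 1) x) ^ 2
      ≤ 4 * ∑ k ∈ Finset.range (2 ^ (m + 1)),
        edist (x (node (m + 1) k)) (x (node (m + 1) (k + 1))) ^ 2 := by
  set S := ∑ k ∈ Finset.range (2 ^ (m + 1)),
    dist (x (node (m + 1) k)) (x (node (m + 1) (k + 1))) ^ 2
  have hS : 0 ≤ S := Finset.sum_nonneg fun _ _ => sq_nonneg _
  have hdist := dist_dyadicInterp_succ_le (R := √S) (m := m) (x := x) fun k hk =>
    Real.le_sqrt_of_sq_le <| Finset.single_le_sum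
      (f := fun k => dist (x (node (m + 1) k)) (x (node (m + 1) (k + 1))) ^ 2)
      (fun _ _ => sq_nonneg _) (Finset.mem_range.2 hk)
  calc edist (dyadicInterp m x) (dyadicInterp (m + 1) x) ^ 2
      = ENNReal.ofReal (dist (dyadicInterp m x) (dyadicInterp (m + 1) x) ^ 2) := by
        rw [edist_dist, ENNReal.ofReal_pow dist_nonneg]
    _ ≤ ENNReal.ofReal (4 * S) := by
        refine ENNReal.ofReal_le_ofReal ((pow_le_pow_left₀ dist_nonneg hdist 2).trans_eq ?_)
        rw [mul_pow, Real.sq_sqrt hS]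
        norm_num
    _ = _ := by
        rw [ENNReal.ofReal_mul zero_le_four, ENNReal.ofReal_ofNat,
          ENNReal.ofReal_sum_of_nonneg fun _ _ => sq_nonneg _]
        simp only [edist_dist, ENNReal.ofReal_pow dist_nonneg]

end DyadicInterpolation

/-! ### Continuous modifications and weak convergence in `C[0,1]` -/

section Kolmogorov

open scoped NNReal ENNReal

variable {Ω : Type*} [MeasurableSpace Ω] {P : Measure Ω}

lemma isAEKolmogorovProcess_of_sq_eLpNorm_sub_le {T : Type*} [PseudoEMetricSpace T]
    {X : T → Ω → ℝ} {q : ℝ} {M : ℝ≥0} (hX : ∀ t, AEMeasurable (X t) P) (hq : 0 < q)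
    (h : ∀ s t, eLpNorm (X s - X t) 2 P ^ 2 ≤ M * edist s t ^ q) :
    IsAEKolmogorovProcess X P 2 q M := by
  refine ⟨fun t => (hX t).mk (X t), .mk_of_secondCountableTopology
    (fun t => (hX t).measurable_mk) (fun s t => ?_) two_pos hq, fun t => (hX t).ae_eq_mk⟩
  refine le_of_eq_of_le ?_ (h s t)
  rw [sq_eLpNorm_two]
  refine lintegral_congr_ae ?_
  filter_upwards [(hX s).ae_eq_mk, (hX t).ae_eq_mk] with ω hs ht
  rw [← hs, ← ht, ENNReal.rpow_two, edist_eq_enorm_sub, Pi.sub_apply]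

lemma aemeasurable_dyadicInterp {X : unitInterval → Ω → ℝ} (hX : ∀ t, AEMeasurable (X t) P)
    (m : ℕ) : AEMeasurable (fun ω => dyadicInterp m fun t => X t ω) P := by
  have hc : Continuous fun v : Fin (2 ^ m + 1) → ℝ => ∑ k, v k • hat m k := by fun_prop
  have hv : AEMeasurable (fun ω (k : Fin (2 ^ m + 1)) => X (node m k) ω) P :=
    aemeasurable_pi_lambda _ fun k => hX _
  refine (hc.measurable.comp_aemeasurable hv).congr (ae_of_all _ fun ω => ?_)
  simp only [Function.comp, dyadicInterp, Finset.sum_range]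

lemma aemeasurable_of_eval {X : Ω → C(unitInterval, ℝ)}
    (hX : ∀ t, AEMeasurable (fun ω => X ω t) P) : AEMeasurable X P :=
  aemeasurable_of_tendsto_metrizable_ae' (fun m => aemeasurable_dyadicInterp hX m)
    (ae_of_all _ fun ω => tendsto_dyadicInterp (X ω))

lemma sq_lintegral_le_lintegral_sq [IsProbabilityMeasure P] {f : Ω → ℝ≥0∞}
    (hf : AEMeasurable f P) : (∫⁻ ω, f ω ∂P) ^ 2 ≤ ∫⁻ ω, f ω ^ 2 ∂P := by
  have h := ENNReal.lintegral_mul_le_Lp_mul_Lq P .two_two hf (aemeasurable_const (b := 1))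
  simp only [Pi.mul_apply, mul_one, ENNReal.rpow_two, one_pow, lintegral_const, measure_univ,
    ENNReal.one_rpow] at h
  refine (pow_le_pow_left' h 2).trans_eq ?_
  rw [← ENNReal.rpow_natCast, ← ENNReal.rpow_mul]
  norm_num

/-- The ratio of the geometric decay of `E‖I_m X - I_{m+1} X‖`, where `I_m` is the dyadic
interpolation of level `m`, for a process with `E|X_s - X_t|² ≤ M |s - t|^q`. -/
def dyadicRate (q : ℝ) : ℝ≥0∞ := 2 ^ ((1 - q) / 2)

lemma dyadicRate_lt_one {q : ℝ} (hq : 1 < q) : dyadicRate q < 1 :=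
  ENNReal.rpow_lt_one_of_one_lt_of_neg (by norm_num) (by linarith)

lemma two_pow_mul_rpow_eq_sq_dyadicRate_pow (q : ℝ) (n : ℕ) :
    (2 : ℝ≥0∞) ^ n * (2⁻¹ ^ n) ^ q = (dyadicRate q ^ n) ^ 2 := by
  simp only [dyadicRate, ← ENNReal.rpow_natCast, ← ENNReal.rpow_neg_one, ← ENNReal.rpow_mul]
  rw [← ENNReal.rpow_add _ _ two_ne_zero ENNReal.ofNat_ne_top]
  congr 1
  push_cast
  ring

variable {q : ℝ} {M : ℝ≥0}

lemma lintegral_sq_edist_le {X : unitInterval → Ω → ℝ} (hX : IsAEKolmogorovProcess X P 2 q M)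
    (s t : unitInterval) : ∫⁻ ω, edist (X s ω) (X t ω) ^ 2 ∂P ≤ M * edist s t ^ q := by
  simpa only [ENNReal.rpow_two] using hX.kolmogorovCondition s t

lemma lintegral_sq_edist_dyadicInterp_succ_le {X : unitInterval → Ω → ℝ}
    (hX : IsAEKolmogorovProcess X P 2 q M) (m : ℕ) :
    ∫⁻ ω, edist (dyadicInterp m fun t => X t ω) (dyadicInterp (m + 1) fun t => X t ω) ^ 2 ∂P
      ≤ 4 * (M * (dyadicRate q ^ (m + 1)) ^ 2) := by
  calc ∫⁻ ω, edist (dyadicInterp m fun t => X t ω) (dyadicInterp (m + 1) fun t => X t ω) ^ 2 ∂P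
      ≤ ∫⁻ ω, 4 * ∑ k ∈ Finset.range (2 ^ (m + 1)),
          edist (X (node (m + 1) k) ω) (X (node (m + 1) (k + 1)) ω) ^ 2 ∂P :=
        lintegral_mono fun ω => sq_edist_dyadicInterp_succ_le m fun t => X t ω
    _ = 4 * ∑ k ∈ Finset.range (2 ^ (m + 1)),
          ∫⁻ ω, edist (X (node (m + 1) k) ω) (X (node (m + 1) (k + 1)) ω) ^ 2 ∂P := by
        rw [lintegral_const_mul' _ _ (by simp),
          lintegral_finsetSum' _ fun k _ => hX.aemeasurable_edist.pow_const 2]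
    _ ≤ 4 * ∑ _k ∈ Finset.range (2 ^ (m + 1)), (M : ℝ≥0∞) * (2⁻¹ ^ (m + 1)) ^ q := by
        gcongr with k
        refine (lintegral_sq_edist_le hX _ _).trans ?_
        gcongr
        · exact hX.q_pos.le
        · exact edist_node_succ_le _ k
    _ = 4 * (M * (dyadicRate q ^ (m + 1)) ^ 2) := by
        rw [Finset.sum_const, Finset.card_range, nsmul_eq_mul,
          ← two_pow_mul_rpow_eq_sq_dyadicRate_pow]
        push_cast
        ring

variable [IsProbabilityMeasure P]

lemma lintegral_edist_dyadicInterp_succ_le {X : unitInterval → Ω → ℝ}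
    (hX : IsAEKolmogorovProcess X P 2 q M) (m : ℕ) :
    ∫⁻ ω, edist (dyadicInterp m fun t => X t ω) (dyadicInterp (m + 1) fun t => X t ω) ∂P
      ≤ 2 * NNReal.sqrt M * dyadicRate q ^ (m + 1) := by
  rw [← ENNReal.pow_le_pow_left_iff two_ne_zero]
  refine (sq_lintegral_le_lintegral_sq ((aemeasurable_dyadicInterp hX.aemeasurable _).edist
    (aemeasurable_dyadicInterp hX.aemeasurable _))).trans
    ((lintegral_sq_edist_dyadicInterp_succ_le hX m).trans_eq ?_)
  rw [mul_pow, mul_pow, ← ENNReal.coe_pow, NNReal.sq_sqrt]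
  ring

lemma tsum_lintegral_edist_dyadicInterp_le {X : unitInterval → Ω → ℝ}
    (hX : IsAEKolmogorovProcess X P 2 q M) (m : ℕ) :
    ∑' j, ∫⁻ ω, edist (dyadicInterp (m + j) fun t => X t ω)
        (dyadicInterp (m + j + 1) fun t => X t ω) ∂P
      ≤ 2 * NNReal.sqrt M * (1 - dyadicRate q)⁻¹ * dyadicRate q ^ (m + 1) := by
  refine (ENNReal.tsum_le_tsum fun j =>
    lintegral_edist_dyadicInterp_succ_le hX (m + j)).trans_eq ?_
  simp only [add_right_comm m _ 1, pow_add _ (m + 1)]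
  rw [ENNReal.tsum_mul_left, ENNReal.tsum_mul_left, ENNReal.tsum_geometric]
  ring

lemma lintegral_edist_dyadicInterp_le {X : Ω → C(unitInterval, ℝ)}
    (hX : IsAEKolmogorovProcess (fun t ω => X ω t) P 2 q M) (m : ℕ) :
    ∫⁻ ω, edist (dyadicInterp m (X ω)) (X ω) ∂P
      ≤ 2 * NNReal.sqrt M * (1 - dyadicRate q)⁻¹ * dyadicRate q ^ (m + 1) := by
  refine le_trans ?_ (tsum_lintegral_edist_dyadicInterp_le hX m)
  rw [← lintegral_tsum fun j => (aemeasurable_dyadicInterp hX.aemeasurable _).edist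
    (aemeasurable_dyadicInterp hX.aemeasurable _)]
  exact lintegral_mono fun ω => edist_le_tsum_of_edist_le_of_tendsto
    (fun n => edist (dyadicInterp n (X ω)) (dyadicInterp (n + 1) (X ω))) (fun _ => le_rfl)
    (tendsto_dyadicInterp (X ω)) m

lemma tendsto_dyadicRate_bound (hq : 1 < q) :
    Tendsto (fun m => 2 * NNReal.sqrt M * (1 - dyadicRate q)⁻¹ * dyadicRate q ^ (m + 1)) atTop
      (𝓝 0) := by
  have hpow := (tendsto_add_atTop_iff_nat 1).2
    (ENNReal.tendsto_pow_atTop_nhds_zero_of_lt_one (dyadicRate_lt_one hq))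
  have hconst : 2 * NNReal.sqrt M * (1 - dyadicRate q)⁻¹ ≠ ∞ :=
    ENNReal.mul_ne_top (by finiteness)
      (ENNReal.inv_ne_top.2 (tsub_pos_of_lt (dyadicRate_lt_one hq)).ne')
  simpa using ENNReal.Tendsto.const_mul hpow (.inr hconst)

lemma ae_exists_tendsto_dyadicInterp {X : unitInterval → Ω → ℝ}
    (hX : IsAEKolmogorovProcess X P 2 q M) (hq : 1 < q) :
    ∀ᵐ ω ∂P, ∃ z, Tendsto (fun m => dyadicInterp m fun t => X t ω) atTop (𝓝 z) := by
  have hmeas := fun m => (aemeasurable_dyadicInterp hX.aemeasurable m).edist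
    (aemeasurable_dyadicInterp hX.aemeasurable (m + 1))
  have hsum : ∫⁻ ω, ∑' m, edist (dyadicInterp m fun t => X t ω)
      (dyadicInterp (m + 1) fun t => X t ω) ∂P ≠ ∞ := by
    rw [lintegral_tsum hmeas]
    refine ne_top_of_le_ne_top ?_ (by simpa using tsum_lintegral_edist_dyadicInterp_le hX 0)
    exact ENNReal.mul_ne_top (ENNReal.mul_ne_top (by finiteness)
      (ENNReal.inv_ne_top.2 (tsub_pos_of_lt (dyadicRate_lt_one hq)).ne'))
      (dyadicRate_lt_one hq).ne_top
  filter_upwards [ae_lt_top' (AEMeasurable.tsum hmeas) hsum] with ω hω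
  exact cauchySeq_tendsto_of_complete
    (cauchySeq_of_edist_le_of_tsum_ne_top _ (fun _ => le_rfl) hω.ne)

omit [IsProbabilityMeasure P] in
lemma eLpNorm_dyadicInterp_sub_le {X : unitInterval → Ω → ℝ} (hX : ∀ t, AEMeasurable (X t) P)
    {m : ℕ} {t : unitInterval} {b : ℝ≥0∞}
    (h : ∀ k, hat m k t ≠ 0 → eLpNorm (X (node m k) - X t) 2 P ≤ b) :
    eLpNorm (fun ω => dyadicInterp m (fun s => X s ω) t - X t ω) 2 P ≤ b := by
  have hsum : (fun ω => dyadicInterp m (fun s => X s ω) t - X t ω)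
      = ∑ k ∈ Finset.range (2 ^ m + 1), hat m k t • (X (node m k) - X t) := by
    ext ω
    simp [dyadicInterp_sub_apply]
  calc eLpNorm (fun ω => dyadicInterp m (fun s => X s ω) t - X t ω) 2 P
      ≤ ∑ k ∈ Finset.range (2 ^ m + 1), eLpNorm (hat m k t • (X (node m k) - X t)) 2 P := by
        rw [hsum]
        exact eLpNorm_sum_le (fun k _ => (((hX _).sub (hX t)).aestronglyMeasurable.const_smul _))
          one_le_two
    _ ≤ ∑ k ∈ Finset.range (2 ^ m + 1), ENNReal.ofReal (hat m k t) * b := by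
        refine Finset.sum_le_sum fun k _ => ?_
        rw [eLpNorm_const_smul, ← Real.enorm_of_nonneg (hat_nonneg m k t)]
        by_cases hk : hat m k t = 0
        · simp [hk]
        · gcongr
          exact h k hk
    _ = b := by
        rw [← Finset.sum_mul, ← ENNReal.ofReal_sum_of_nonneg fun k _ => hat_nonneg m k t, sum_hat,
          ENNReal.ofReal_one, one_mul]

omit [IsProbabilityMeasure P] in
lemma tendsto_eLpNorm_dyadicInterp_sub {X : unitInterval → Ω → ℝ}
    (hX : IsAEKolmogorovProcess X P 2 q M) (t : unitInterval) :
    Tendsto (fun m => eLpNorm (fun ω => dyadicInterp m (fun s => X s ω) t - X t ω) 2 P) atTop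
      (𝓝 0) := by
  have hq2 : 0 < q / 2 := half_pos hX.q_pos
  have hlim : Tendsto (fun m : ℕ => NNReal.sqrt M * ((2⁻¹ : ℝ≥0∞) ^ m) ^ (q / 2)) atTop (𝓝 0) := by
    have h := ((ENNReal.continuous_rpow_const (y := q / 2)).tendsto _).comp
      (ENNReal.tendsto_pow_atTop_nhds_zero_of_lt_one (r := 2⁻¹) (by simp))
    rw [ENNReal.zero_rpow_of_pos hq2] at h
    simpa using ENNReal.Tendsto.const_mul h (.inr (ENNReal.coe_ne_top (r := NNReal.sqrt M)))
  refine tendsto_of_tendsto_of_tendsto_of_le_of_le tendsto_const_nhds hlim (fun _ => zero_le)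
    fun m => eLpNorm_dyadicInterp_sub_le hX.aemeasurable fun k hk => ?_
  rw [← ENNReal.pow_le_pow_left_iff two_ne_zero, sq_eLpNorm_two, mul_pow, ← ENNReal.coe_pow,
    NNReal.sq_sqrt, ← ENNReal.rpow_natCast, ← ENNReal.rpow_mul]
  simp only [Pi.sub_apply, ← edist_eq_enorm_sub]
  refine (lintegral_sq_edist_le hX _ _).trans ?_
  push_cast
  rw [div_mul_cancel₀ q two_ne_zero]
  gcongr
  · exact hX.q_pos.le
  · exact edist_le_inv_two_pow (dist_node_le_of_hat_ne_zero hk)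

lemma exists_continuous_modification {X : unitInterval → Ω → ℝ}
    (hX : IsAEKolmogorovProcess X P 2 q M) (hq : 1 < q) :
    ∃ ζ : Ω → C(unitInterval, ℝ), ∀ t, (fun ω => ζ ω t) =ᵐ[P] X t := by
  obtain ⟨ζ, hζ⟩ : ∃ ζ : Ω → C(unitInterval, ℝ), ∀ᵐ ω ∂P,
      Tendsto (fun m => dyadicInterp m fun t => X t ω) atTop (𝓝 (ζ ω)) := by
    classical
    choose! ζ hζ using fun ω (h : ∃ z, Tendsto (fun m => dyadicInterp m fun t => X t ω) atTop
      (𝓝 z)) => h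
    exact ⟨ζ, (ae_exists_tendsto_dyadicInterp hX hq).mono hζ⟩
  refine ⟨ζ, fun t => ?_⟩
  have hmeas : ∀ m, AEStronglyMeasurable (fun ω => dyadicInterp m (fun s => X s ω) t) P := fun m =>
    ((continuous_eval_const t).measurable.comp_aemeasurable
      (aemeasurable_dyadicInterp hX.aemeasurable m)).aestronglyMeasurable
  refine tendstoInMeasure_ae_unique (tendstoInMeasure_of_tendsto_ae hmeas ?_)
    (tendstoInMeasure_of_tendsto_eLpNorm two_ne_zero hmeas (hX.aemeasurable t).aestronglyMeasurable
      (tendsto_eLpNorm_dyadicInterp_sub hX t))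
  filter_upwards [hζ] with ω hω using ((continuous_eval_const t).tendsto _).comp hω

end Kolmogorov

section Criterion

open scoped NNReal ENNReal

variable {Ω Ω' : Type*} [MeasurableSpace Ω] {P : Measure Ω} [IsProbabilityMeasure P]
  [MeasurableSpace Ω'] {P' : Measure Ω'} [IsProbabilityMeasure P']

lemma enorm_integral_map_sub_integral_map_le {E : Type*} [PseudoEMetricSpace E] [MeasurableSpace E]
    [OpensMeasurableSpace E] {X Y : Ω → E} (hX : AEMeasurable X P) (hY : AEMeasurable Y P)
    {F : E → ℝ} {K : ℝ} (hK : ∀ x y, dist (F x) (F y) ≤ K) {L : ℝ≥0} (hL : LipschitzWith L F) :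
    ‖∫ x, F x ∂(P.map X) - ∫ x, F x ∂(P.map Y)‖ₑ ≤ L * ∫⁻ ω, edist (X ω) (Y ω) ∂P := by
  obtain ⟨ω₀⟩ := nonempty_of_isProbabilityMeasure P
  have hinteg : ∀ {U : Ω → E}, AEMeasurable U P → Integrable (fun ω => F (U ω)) P := fun hU =>
    Integrable.of_bound (hL.continuous.measurable.comp_aemeasurable hU).aestronglyMeasurable
      (K + ‖F (X ω₀)‖) (ae_of_all _ fun ω => (norm_le_norm_sub_add _ (F (X ω₀))).trans
        (by gcongr; exact hK _ _))
  rw [integral_map hX hL.continuous.measurable.aestronglyMeasurable,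
    integral_map hY hL.continuous.measurable.aestronglyMeasurable,
    ← integral_sub (hinteg hX) (hinteg hY)]
  calc ‖∫ ω, F (X ω) - F (Y ω) ∂P‖ₑ
      ≤ ∫⁻ ω, ‖F (X ω) - F (Y ω)‖ₑ ∂P := enorm_integral_le_lintegral_enorm _
    _ ≤ ∫⁻ ω, L * edist (X ω) (Y ω) ∂P := lintegral_mono fun ω => by
        rw [← edist_eq_enorm_sub]
        exact hL _ _
    _ = L * ∫⁻ ω, edist (X ω) (Y ω) ∂P := lintegral_const_mul' _ _ ENNReal.coe_ne_top

lemma tendstoInDistribution_of_lintegral_edist_le {ι E : Type*} {l : Filter ι}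
    [l.IsCountablyGenerated] [PseudoEMetricSpace E] [MeasurableSpace E] [OpensMeasurableSpace E]
    {X : ι → Ω → E} {ζ : Ω' → E} (hX : ∀ i, AEMeasurable (X i) P) (hζ : AEMeasurable ζ P')
    {X' : ℕ → ι → Ω → E} {ζ' : ℕ → Ω' → E} {b : ℕ → ℝ≥0∞} (hb : Tendsto b atTop (𝓝 0))
    (hXX' : ∀ m i, ∫⁻ ω, edist (X' m i ω) (X i ω) ∂P ≤ b m)
    (hζζ' : ∀ m, ∫⁻ ω, edist (ζ' m ω) (ζ ω) ∂P' ≤ b m)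
    (hlim : ∀ m, TendstoInDistribution (X' m) l (ζ' m) (fun _ => P) P') :
    TendstoInDistribution X l ζ (fun _ => P) P' := by
  refine ⟨hX, hζ, tendsto_iff_forall_lipschitz_integral_tendsto.2 ?_⟩
  rintro F ⟨K, hK⟩ ⟨L, hL⟩
  have hLb : Tendsto (fun m => L * b m) atTop (𝓝 0) := by
    simpa using ENNReal.Tendsto.const_mul hb (.inr (ENNReal.coe_ne_top (r := L)))
  refine TendstoUniformly.tendsto_of_eventually_tendsto (p := atTop)
    (F := fun m i => ∫ x, F x ∂(P.map (X' m i))) (L := fun m => ∫ x, F x ∂(P'.map (ζ' m))) ?_ ?_ ?_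
  · refine EMetric.tendstoUniformly_iff.2 fun ε hε => ?_
    filter_upwards [hLb.eventually_lt_const hε] with m hm i
    rw [edist_comm, edist_eq_enorm_sub]
    refine lt_of_le_of_lt ?_ hm
    grw [← hXX' m i]
    exact enorm_integral_map_sub_integral_map_le ((hlim m).forall_aemeasurable i) (hX i) hK hL
  · exact .of_forall fun m =>
      tendsto_iff_forall_lipschitz_integral_tendsto.1 (hlim m).tendsto F ⟨K, hK⟩ ⟨L, hL⟩
  · refine tendsto_iff_edist_tendsto_0.2 (tendsto_of_tendsto_of_tendsto_of_le_of_le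
      tendsto_const_nhds hLb (fun _ => zero_le) fun m => ?_)
    rw [edist_eq_enorm_sub]
    grw [← hζζ' m]
    exact enorm_integral_map_sub_integral_map_le (hlim m).aemeasurable_limit hζ hK hL

omit [IsProbabilityMeasure P] in
lemma charFun_map_toLp {N : ℕ} {V : Fin N → Ω → ℝ} (hV : ∀ i, AEMeasurable (V i) P)
    (θ : EuclideanSpace ℝ (Fin N)) :
    charFun (P.map fun ω => WithLp.toLp 2 fun i => V i ω) θ
      = charFun (P.map fun ω => ∑ i, θ i * V i ω) 1 := by
  have h1 : AEMeasurable (fun ω => (WithLp.toLp 2 fun i => V i ω : EuclideanSpace ℝ (Fin N))) P :=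
    (PiLp.continuous_toLp 2 _).measurable.comp_aemeasurable (aemeasurable_pi_lambda _ hV)
  have h2 : AEMeasurable (fun ω => ∑ i, θ i * V i ω) P :=
    Finset.aemeasurable_fun_sum _ fun i _ => (hV i).const_mul _
  rw [charFun_apply, charFun_apply, integral_map h1 (by fun_prop), integral_map h2 (by fun_prop)]
  refine integral_congr_ae (ae_of_all _ fun ω => ?_)
  simp [PiLp.inner_apply]

/-- The Cramér–Wold device. -/
lemma tendstoInDistribution_toLp_of_charFun {N : ℕ}
    {V : ℕ → Fin N → Ω → ℝ} {U : Fin N → Ω' → ℝ} (hV : ∀ n i, AEMeasurable (V n i) P)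
    (hU : ∀ i, AEMeasurable (U i) P')
    (h : ∀ θ : Fin N → ℝ, Tendsto (fun n => charFun (P.map fun ω => ∑ i, θ i * V n i ω) 1) atTop
      (𝓝 (charFun (P'.map fun ω => ∑ i, θ i * U i ω) 1))) :
    TendstoInDistribution
      (fun n ω => (WithLp.toLp 2 fun i => V n i ω : EuclideanSpace ℝ (Fin N))) atTop
      (fun ω => WithLp.toLp 2 fun i => U i ω) (fun _ => P) P' where
  forall_aemeasurable n :=
    (PiLp.continuous_toLp 2 _).measurable.comp_aemeasurable (aemeasurable_pi_lambda _ (hV n))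
  aemeasurable_limit :=
    (PiLp.continuous_toLp 2 _).measurable.comp_aemeasurable (aemeasurable_pi_lambda _ hU)
  tendsto := by
    refine ProbabilityMeasure.tendsto_iff_tendsto_charFun.2 fun θ => ?_
    simp only [ProbabilityMeasure.coe_mk, charFun_map_toLp hU, charFun_map_toLp (hV _)]
    exact h θ

lemma tendstoInDistribution_of_isAEKolmogorovProcess {X : ℕ → Ω → C(unitInterval, ℝ)}
    {ζ : Ω' → C(unitInterval, ℝ)} {q : ℝ} {M : ℝ≥0} (hq : 1 < q)
    (hX : ∀ n, IsAEKolmogorovProcess (fun t ω => X n ω t) P 2 q M)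
    (hζ : IsAEKolmogorovProcess (fun t ω => ζ ω t) P' 2 q M)
    (hfdd : ∀ (N : ℕ) (τ : Fin N → unitInterval) (θ : Fin N → ℝ),
      Tendsto (fun n => charFun (P.map fun ω => ∑ i, θ i * X n ω (τ i)) 1) atTop
        (𝓝 (charFun (P'.map fun ω => ∑ i, θ i * ζ ω (τ i)) 1))) :
    TendstoInDistribution X atTop ζ (fun _ => P) P' := by
  refine tendstoInDistribution_of_lintegral_edist_le
    (fun n => aemeasurable_of_eval (hX n).aemeasurable) (aemeasurable_of_eval hζ.aemeasurable)
    (tendsto_dyadicRate_bound (M := M) hq)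
    (fun m n => lintegral_edist_dyadicInterp_le (hX n) m) (lintegral_edist_dyadicInterp_le hζ)
    fun m => ?_
  have hnodes := tendstoInDistribution_toLp_of_charFun (N := 2 ^ m + 1)
    (V := fun n i ω => X n ω (node m i)) (U := fun i ω => ζ ω (node m i))
    (fun n i => (hX n).aemeasurable _) (fun i => hζ.aemeasurable _)
    (hfdd _ fun i => node m i)
  have hcont : Continuous fun v : EuclideanSpace ℝ (Fin (2 ^ m + 1)) => ∑ k, v k • hat m k := by
    fun_prop
  simpa only [Function.comp_def, dyadicInterp, Finset.sum_range] using
    hnodes.continuous_comp hcont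

end Criterion

/-! ### The coefficients of the tempered fractional difference operator -/

section Coefficients

variable {α lam : ℝ}

lemma multichoose_eq_prod_div (α : ℝ) (j : ℕ) :
    Ring.multichoose α j = (∏ i ∈ Finset.range j, (α + i)) / (j.factorial : ℝ) := by
  have heval : (ascPochhammer ℝ j).eval α = ∏ i ∈ Finset.range j, (α + i) := by
    induction j with
    | zero => simp
    | succ j ih => rw [ascPochhammer_succ_eval, ih, Finset.prod_range_succ]
  rw [← heval, ← Polynomial.ascPochhammer_smeval_eq_eval,
    ← Ring.factorial_nsmul_multichoose_eq_ascPochhammer, nsmul_eq_mul,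
    mul_div_cancel_left₀ _ (by positivity)]

lemma multichoose_nonneg (hα : 0 < α) (j : ℕ) : 0 ≤ Ring.multichoose α j := by
  rw [multichoose_eq_prod_div]
  positivity

lemma coeff_neg_eq (α lam : ℝ) (j : ℕ) :
    coeff (-α) lam j = Ring.multichoose α j * Real.exp (-(lam * j)) := by
  rw [coeff, Ring.choose_neg', Int.negOnePow_def, Units.smul_def, zsmul_eq_mul, zpow_natCast]
  push_cast
  rw [← mul_assoc, ← mul_pow]
  simp

lemma coeff_neg_nonneg (hα : 0 < α) (lam : ℝ) (j : ℕ) : 0 ≤ coeff (-α) lam j := by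
  rw [coeff_neg_eq]
  exact mul_nonneg (multichoose_nonneg hα j) (Real.exp_pos _).le

lemma tendsto_multichoose_mul_rpow (hα : 0 < α) :
    Tendsto (fun j : ℕ => Ring.multichoose α j * (j : ℝ) ^ (1 - α)) atTop
      (𝓝 (Real.Gamma α)⁻¹) := by
  have hGamma := (Real.GammaSeq_tendsto_Gamma α).inv₀ (Real.Gamma_pos_of_pos hα).ne'
  have hratio : Tendsto (fun j : ℕ => (j : ℝ) / (α + j)) atTop (𝓝 1) := by
    simpa only [add_comm] using tendsto_natCast_div_add_atTop (𝕜 := ℝ) α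
  rw [← one_mul (Real.Gamma α)⁻¹]
  refine (hratio.mul hGamma).congr' ?_
  filter_upwards [eventually_gt_atTop 0] with j hj
  have hj : (0 : ℝ) < j := by exact_mod_cast hj
  have hprod : (∏ i ∈ Finset.range j, (α + (i : ℝ))) ≠ 0 :=
    (Finset.prod_pos fun i _ => by positivity).ne'
  rw [Real.GammaSeq, Finset.prod_range_succ, multichoose_eq_prod_div, Real.rpow_sub hj,
    Real.rpow_one]
  have := (Real.rpow_pos_of_pos hj α).ne'
  field_simp

lemma exists_multichoose_le (hα : 0 < α) :
    ∃ K : ℝ, 0 ≤ K ∧ ∀ j : ℕ, Ring.multichoose α j ≤ K * ((j : ℝ) + 1) ^ (α - 1) := by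
  have hratio : Tendsto (fun j : ℕ => (((j : ℝ) + 1) / j) ^ (1 - α)) atTop (𝓝 1) := by
    have := (tendsto_natCast_div_add_atTop (𝕜 := ℝ) 1).inv₀ one_ne_zero
    simp only [inv_div, inv_one] at this
    simpa using this.rpow_const (p := 1 - α) (.inl one_ne_zero)
  have hlim : Tendsto (fun j : ℕ => Ring.multichoose α j * ((j : ℝ) + 1) ^ (1 - α)) atTop
      (𝓝 ((Real.Gamma α)⁻¹ * 1)) := by
    refine ((tendsto_multichoose_mul_rpow hα).mul hratio).congr' ?_
    filter_upwards [eventually_gt_atTop 0] with j hj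
    have hj : (0 : ℝ) < j := by exact_mod_cast hj
    rw [mul_assoc, ← Real.mul_rpow hj.le (by positivity), mul_div_cancel₀ _ hj.ne']
  obtain ⟨K, hK⟩ := hlim.bddAbove_range
  have hbound (j : ℕ) : Ring.multichoose α j * ((j : ℝ) + 1) ^ (1 - α) ≤ K := hK ⟨j, rfl⟩
  refine ⟨K, (mul_nonneg (multichoose_nonneg hα 0) (by positivity)).trans (hbound 0), fun j => ?_⟩
  have hj : (0 : ℝ) < (j : ℝ) + 1 := by positivity
  rw [← neg_sub, Real.rpow_neg hj.le, ← div_eq_mul_inv, le_div_iff₀ (Real.rpow_pos_of_pos hj _)]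
  exact hbound j

lemma summable_abs_coeff_neg (hα : 0 < α) (hlam : 0 < lam) :
    Summable fun j : ℕ => |coeff (-α) lam j| := by
  obtain ⟨K, hK0, hK⟩ := exists_multichoose_le hα
  have hsum := ((summable_nat_add_iff 1).2
    (Real.summable_pow_mul_exp_neg_nat_mul ⌈α⌉₊ hlam)).mul_left (K * Real.exp lam)
  refine hsum.of_nonneg_of_le (fun _ => abs_nonneg _) fun j => ?_
  have hpow : ((j : ℝ) + 1) ^ (α - 1) ≤ ((j : ℝ) + 1) ^ ⌈α⌉₊ := by
    rw [← Real.rpow_natCast]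
    exact Real.rpow_le_rpow_of_exponent_le (by simp) (by linarith [Nat.le_ceil α])
  rw [abs_of_nonneg (coeff_neg_nonneg hα _ _), coeff_neg_eq]
  calc Ring.multichoose α j * Real.exp (-(lam * j))
      ≤ K * ((j : ℝ) + 1) ^ ⌈α⌉₊ * Real.exp (-(lam * j)) := by
        gcongr
        exact (hK j).trans (by gcongr)
    _ = K * Real.exp lam * (((j + 1 : ℕ) : ℝ) ^ ⌈α⌉₊ * Real.exp (-lam * (j + 1 : ℕ))) := by
        have : Real.exp (-(lam * j)) = Real.exp lam * Real.exp (-lam * (j + 1 : ℕ)) := by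
          rw [← Real.exp_add]
          push_cast
          congr 1
          ring
        rw [this]
        push_cast
        ring

lemma tendsto_rpow_mul_coeff_neg (hα : 0 < α) {j : ℕ → ℕ} {u : ℝ} (hu : 0 < u)
    (hj : Tendsto (fun n => (j n : ℝ) / n) atTop (𝓝 u)) :
    Tendsto (fun n : ℕ => (n : ℝ) ^ (1 - α) * coeff (-α) (lam / n) (j n)) atTop
      (𝓝 ((Real.Gamma α)⁻¹ * (u ^ (α - 1) * Real.exp (-(lam * u))))) := by
  have hj_top : Tendsto j atTop atTop := by
    rw [← tendsto_natCast_atTop_iff (R := ℝ)]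
    refine (hj.pos_mul_atTop hu tendsto_natCast_atTop_atTop).congr' ?_
    filter_upwards [eventually_ne_atTop 0] with n hn
    exact div_mul_cancel₀ _ (by exact_mod_cast hn)
  have hbinom := (tendsto_multichoose_mul_rpow hα).comp hj_top
  have hpow := hj.rpow_const (p := α - 1) (.inl hu.ne')
  have hexp : Tendsto (fun n : ℕ => Real.exp (-(lam * ((j n : ℝ) / n)))) atTop
      (𝓝 (Real.exp (-(lam * u)))) := (Real.continuous_exp.tendsto _).comp (hj.const_mul lam).neg
  refine (hbinom.mul (hpow.mul hexp)).congr' ?_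
  filter_upwards [eventually_gt_atTop 0, hj_top.eventually_gt_atTop 0] with n hn hjn
  have hn : (0 : ℝ) < n := by exact_mod_cast hn
  have hjn : (0 : ℝ) < j n := by exact_mod_cast hjn
  have := (Real.rpow_pos_of_pos hjn (1 - α)).ne'
  rw [Function.comp_apply, coeff_neg_eq, Real.div_rpow hjn.le hn.le, ← neg_sub 1 α,
    Real.rpow_neg hjn.le, Real.rpow_neg hn.le, div_mul_eq_mul_div, ← mul_div_assoc]
  field_simp

end Coefficients

/-! ### The rescaled coefficients and the tempered kernel -/

section Kernels

variable {α lam : ℝ}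

/-- The coefficients of the ARTFIMA series, extended by zero to `ℤ`. -/
def intCoeff (α lam : ℝ) (j : ℤ) : ℝ := if 0 ≤ j then coeff (-α) lam j.toNat else 0

/-- The coefficients at scale `1 / n` as a step function on `ℝ × ℝ`, normalised so as to converge
to `temperedKernel α lam / Γ(α)`. -/
def stepKernel (α lam : ℝ) (n : ℕ) (s y : ℝ) : ℝ :=
  (n : ℝ) ^ (1 - α) * intCoeff α (lam / n) (⌊n * s⌋ - ⌊n * y⌋)

/-- The integrand of the tempered Hermite kernel with `α = H - 1/2`. -/
def temperedKernel (α lam s y : ℝ) : ℝ :=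
  if 0 < s - y then (s - y) ^ (α - 1) * Real.exp (-(lam * (s - y))) else 0

/-- The translation invariant majorant of the step kernels and of the tempered kernel; the shift
by `2` absorbs the discretisation error of the steps. -/
def envelope (α lam u : ℝ) : ℝ :=
  (|u| ^ (α - 1) + (|u| + 2) ^ (α - 1)) * Real.exp (-(lam * |u|))

lemma measurable_stepKernel (α lam : ℝ) (n : ℕ) :
    Measurable (Function.uncurry (stepKernel α lam n)) := by
  have hfloor : Measurable fun p : ℝ × ℝ => ⌊(n : ℝ) * p.1⌋ - ⌊(n : ℝ) * p.2⌋ := by fun_prop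
  exact ((measurable_from_top (f := intCoeff α (lam / n))).comp hfloor).const_mul _

lemma measurable_temperedKernel (α lam : ℝ) :
    Measurable (Function.uncurry (temperedKernel α lam)) := by
  unfold Function.uncurry temperedKernel
  exact Measurable.ite (measurableSet_lt measurable_const (by fun_prop)) (by fun_prop)
    measurable_const

lemma measurable_envelope (α lam : ℝ) : Measurable (envelope α lam) := by
  unfold envelope
  fun_prop

lemma tendsto_floor_mul_div (x : ℝ) :
    Tendsto (fun n : ℕ => (⌊(n : ℝ) * x⌋ : ℝ) / n) atTop (𝓝 x) := by
  have hlow : Tendsto (fun n : ℕ => x - (n : ℝ)⁻¹) atTop (𝓝 x) := by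
    simpa using tendsto_const_nhds.sub (tendsto_inv_atTop_nhds_zero_nat (𝕜 := ℝ))
  refine tendsto_of_tendsto_of_tendsto_of_le_of_le' hlow tendsto_const_nhds ?_ ?_
  all_goals
    filter_upwards [eventually_gt_atTop 0] with n hn
    have hn : (0 : ℝ) < n := by exact_mod_cast hn
  · rw [le_div_iff₀ hn, sub_mul, inv_mul_cancel₀ hn.ne']
    linarith [Int.lt_floor_add_one ((n : ℝ) * x)]
  · rw [div_le_iff₀ hn, mul_comm x]
    exact Int.floor_le _

lemma tendsto_stepKernel (hα : 0 < α) {s y : ℝ} (hsy : s ≠ y) :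
    Tendsto (fun n => stepKernel α lam n s y) atTop
      (𝓝 ((Real.Gamma α)⁻¹ * temperedKernel α lam s y)) := by
  have hdiff : Tendsto (fun n : ℕ => ((⌊(n : ℝ) * s⌋ - ⌊(n : ℝ) * y⌋ : ℤ) : ℝ) / n) atTop
      (𝓝 (s - y)) := by
    simpa only [Int.cast_sub, sub_div] using
      (tendsto_floor_mul_div s).sub (tendsto_floor_mul_div y)
  rcases lt_or_gt_of_ne (sub_ne_zero.2 hsy) with hneg | hpos
  · rw [temperedKernel, if_neg hneg.not_gt, mul_zero]
    refine tendsto_const_nhds.congr' ?_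
    filter_upwards [hdiff.eventually_lt_const hneg] with n hn
    have hlt : ⌊(n : ℝ) * s⌋ - ⌊(n : ℝ) * y⌋ < 0 := by
      by_contra! h
      exact hn.not_ge (div_nonneg (by exact_mod_cast h) n.cast_nonneg)
    rw [stepKernel, intCoeff, if_neg hlt.not_ge, mul_zero]
  · rw [temperedKernel, if_pos hpos]
    have hev : ∀ᶠ n : ℕ in atTop, 0 ≤ ⌊(n : ℝ) * s⌋ - ⌊(n : ℝ) * y⌋ := by
      filter_upwards [hdiff.eventually_const_lt hpos] with n hn
      by_contra! h
      exact hn.not_ge (div_nonpos_of_nonpos_of_nonneg (by exact_mod_cast h.le) n.cast_nonneg)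
    have hnat : Tendsto (fun n : ℕ => ((⌊(n : ℝ) * s⌋ - ⌊(n : ℝ) * y⌋).toNat : ℝ) / n) atTop
        (𝓝 (s - y)) := by
      refine hdiff.congr' ?_
      filter_upwards [hev] with n hn
      congr 1
      exact_mod_cast (Int.toNat_of_nonneg hn).symm
    refine (tendsto_rpow_mul_coeff_neg hα hpos hnat).congr' ?_
    filter_upwards [hev] with n hn
    rw [stepKernel, intCoeff, if_pos hn]

lemma rpow_le_rpow_add_rpow (r : ℝ) {a b x : ℝ} (ha : 0 < a) (hax : a ≤ x) (hxb : x ≤ b) :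
    x ^ r ≤ a ^ r + b ^ r := by
  have hx := ha.trans_le hax
  rcases le_total r 0 with hr | hr
  · exact (Real.rpow_le_rpow_of_nonpos ha hax hr).trans
      (le_add_of_nonneg_right (Real.rpow_nonneg (hx.le.trans hxb) r))
  · exact (Real.rpow_le_rpow hx.le hxb hr).trans
      (le_add_of_nonneg_left (Real.rpow_nonneg ha.le r))

lemma rpow_mul_coeff_neg_le_envelope (hlam : 0 < lam) {K : ℝ} (hK0 : 0 ≤ K)
    (hK : ∀ j : ℕ, Ring.multichoose α j ≤ K * ((j : ℝ) + 1) ^ (α - 1)) {n i : ℕ} (hn : 1 ≤ n)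
    {u : ℝ} (hu : u ≠ 0) (hlow : n * u - 1 < i) (hupp : (i : ℝ) < n * u + 1) :
    (n : ℝ) ^ (1 - α) * coeff (-α) (lam / n) i ≤ K * Real.exp lam * envelope α lam u := by
  have hn1 : (1 : ℝ) ≤ n := by exact_mod_cast hn
  have hn0 : (0 : ℝ) < n := by positivity
  have hu_le : |u| ≤ ((i : ℝ) + 1) / n := by
    rw [le_div_iff₀ hn0]
    rcases abs_cases u with h | h <;> rw [h.1] <;> nlinarith [(Nat.cast_nonneg i : (0 : ℝ) ≤ i)]
  have hle_u : ((i : ℝ) + 1) / n ≤ |u| + 2 := by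
    rw [div_le_iff₀ hn0]
    nlinarith [le_abs_self u]
  have hexp : Real.exp (-(lam / n * i)) ≤ Real.exp lam * Real.exp (-(lam * |u|)) := by
    rw [← Real.exp_add, Real.exp_le_exp]
    have : |u| ≤ i / n + 1 := by
      rw [add_div] at hu_le
      exact hu_le.trans (by gcongr; exact div_le_one_of_le₀ hn1 hn0.le)
    rw [div_mul_eq_mul_div, mul_div_assoc]
    nlinarith
  calc (n : ℝ) ^ (1 - α) * coeff (-α) (lam / n) i
      ≤ (n : ℝ) ^ (1 - α) * (K * ((i : ℝ) + 1) ^ (α - 1) * Real.exp (-(lam / n * i))) := by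
        rw [coeff_neg_eq]
        gcongr
        exact hK i
    _ = K * (((i : ℝ) + 1) / n) ^ (α - 1) * Real.exp (-(lam / n * i)) := by
        rw [Real.div_rpow (by positivity) hn0.le, ← neg_sub α, Real.rpow_neg hn0.le]
        ring
    _ ≤ K * (|u| ^ (α - 1) + (|u| + 2) ^ (α - 1)) * (Real.exp lam * Real.exp (-(lam * |u|))) := by
        gcongr
        exact rpow_le_rpow_add_rpow _ (abs_pos.2 hu) hu_le hle_u
    _ = K * Real.exp lam * envelope α lam u := by
        rw [envelope]
        ring

lemma envelope_nonneg (α lam u : ℝ) : 0 ≤ envelope α lam u := by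
  unfold envelope
  positivity

lemma exists_abs_stepKernel_le (hα : 0 < α) (hlam : 0 < lam) :
    ∃ K : ℝ, ∀ n : ℕ, 1 ≤ n → ∀ s y : ℝ, s ≠ y →
      |stepKernel α lam n s y| ≤ K * envelope α lam (s - y) := by
  obtain ⟨K, hK0, hK⟩ := exists_multichoose_le hα
  refine ⟨K * Real.exp lam, fun n hn s y hsy => ?_⟩
  rw [stepKernel, intCoeff]
  split_ifs with h
  · obtain ⟨i, hi⟩ := Int.eq_ofNat_of_zero_le h
    have hcast : (i : ℝ) = ⌊(n : ℝ) * s⌋ - ⌊(n : ℝ) * y⌋ := by exact_mod_cast hi.symm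
    rw [hi, Int.toNat_natCast, abs_of_nonneg
      (mul_nonneg (by positivity) (coeff_neg_nonneg hα _ _))]
    apply rpow_mul_coeff_neg_le_envelope hlam hK0 hK hn (sub_ne_zero.2 hsy)
    all_goals
      rw [hcast]
      linarith [Int.floor_le ((n : ℝ) * s), Int.lt_floor_add_one ((n : ℝ) * s),
        Int.floor_le ((n : ℝ) * y), Int.lt_floor_add_one ((n : ℝ) * y)]
  · rw [mul_zero, abs_zero]
    exact mul_nonneg (by positivity) (envelope_nonneg _ _ _)

lemma abs_temperedKernel_le (α lam s y : ℝ) :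
    |temperedKernel α lam s y| ≤ envelope α lam (s - y) := by
  rw [temperedKernel]
  split_ifs with h
  · rw [abs_of_nonneg (by positivity), envelope, abs_of_pos h]
    gcongr
    exact le_add_of_nonneg_right (by positivity)
  · simpa using envelope_nonneg _ _ _

lemma integrable_abs_add_rpow_mul_exp {a r b : ℝ} (ha : 0 ≤ a) (hr : -1 < r) (hb : 0 < b) :
    Integrable fun u : ℝ => (|u| + a) ^ r * Real.exp (-(b * |u|)) := by
  have hgamma : IntegrableOn (fun x : ℝ => x ^ r * Real.exp (-(b * x))) (Set.Ioi a) := by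
    simpa using (integrableOn_rpow_mul_exp_neg_mul_rpow hr zero_lt_one hb).mono_set
      (Set.Ioi_subset_Ioi ha)
  refine (integrable_fun_norm_addHaar volume
    (f := fun x => (x + a) ^ r * Real.exp (-(b * x)))).2 ?_
  have hshift := (MeasurePreserving.integrableOn_comp_preimage
    (measurePreserving_add_right volume a) (measurableEmbedding_addRight a)).2 hgamma
  have hshift' : IntegrableOn (fun x : ℝ => (x + a) ^ r * Real.exp (-(b * (x + a)))) (Set.Ioi 0) :=
    hshift.mono_set fun x hx => by simpa using hx
  refine IntegrableOn.congr_fun (Integrable.const_mul hshift' (Real.exp (b * a)))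
    (fun x _ => ?_) measurableSet_Ioi
  rw [Module.finrank_self, Nat.sub_self, pow_zero, one_smul, mul_left_comm, ← Real.exp_add]
  ring_nf

lemma memLp_abs_add_rpow_mul_exp {a r b q : ℝ} (ha : 0 ≤ a) (hb : 0 < b) (hq : 0 < q)
    (hqr : -1 < q * r) :
    MemLp (fun u : ℝ => (|u| + a) ^ r * Real.exp (-(b * |u|))) (ENNReal.ofReal q) := by
  rw [← integrable_norm_rpow_iff (by fun_prop) (by simpa) ENNReal.ofReal_ne_top,
    ENNReal.toReal_ofReal hq.le]
  refine (integrable_abs_add_rpow_mul_exp ha hqr (mul_pos hq hb)).congr (ae_of_all _ fun u => ?_)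
  dsimp only
  rw [Real.norm_of_nonneg (by positivity), Real.mul_rpow (by positivity) (by positivity),
    ← Real.exp_mul, ← Real.rpow_mul (by positivity), mul_comm r]
  congr 2
  ring

lemma memLp_envelope (hlam : 0 < lam) {q : ℝ} (hq : 0 < q) (hqα : -1 < q * (α - 1)) :
    MemLp (envelope α lam) (ENNReal.ofReal q) := by
  refine ((memLp_abs_add_rpow_mul_exp le_rfl hlam hq hqα).add
    (memLp_abs_add_rpow_mul_exp zero_le_two hlam hq hqα)).ae_eq (ae_of_all _ fun u => ?_)
  rw [Pi.add_apply, add_zero, envelope, add_mul]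

/-- The exponent `q = 1 + α` serves: `q (α - 1) > -1`. -/
lemma exists_kernel_majorant (hα : 0 < α) (hlam : 0 < lam) :
    ∃ h : ℝ → ENNReal, Measurable h ∧ ∫⁻ u, h u ≠ ⊤ ∧ (∃ q : ℝ, 1 < q ∧ ∫⁻ u, h u ^ q ≠ ⊤) ∧
      (∀ n : ℕ, 1 ≤ n → ∀ s y : ℝ, s ≠ y → ‖stepKernel α lam n s y‖ₑ ≤ h (s - y)) ∧
      ∀ s y : ℝ, s ≠ y → ‖temperedKernel α lam s y‖ₑ ≤ h (s - y) := by
  obtain ⟨K, hK⟩ := exists_abs_stepKernel_le hα hlam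
  have hLq {q : ℝ} (hq : 0 < q) (hqα : -1 < q * (α - 1)) :
      ∫⁻ u, ‖max K 1 * envelope α lam u‖ₑ ^ q ≠ ⊤ := by
    have := lintegral_rpow_enorm_lt_top_of_eLpNorm_lt_top (by simpa) ENNReal.ofReal_ne_top
      ((memLp_envelope hlam hq hqα).const_mul (max K 1)).2
    rw [ENNReal.toReal_ofReal hq.le] at this
    exact this.ne
  refine ⟨fun u => ‖max K 1 * envelope α lam u‖ₑ,
    ((measurable_envelope α lam).const_mul _).enorm,
    by simpa using hLq one_pos (by linarith),
    ⟨1 + α, by linarith, hLq (by linarith) (by nlinarith)⟩,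
    fun n hn s y hsy => ?_, fun s y _ => ?_⟩
  all_goals
    refine enorm_le_iff_norm_le.2 (le_trans ?_ (le_abs_self _))
    rw [Real.norm_eq_abs]
  · grw [hK n hn s y hsy, ← le_max_left K 1]
    exact envelope_nonneg _ _ _
  · grw [abs_temperedKernel_le, ← le_max_right K 1, one_mul]
    exact envelope_nonneg _ _ _

end Kernels

/-! ### Time integrals of kernels with a translation invariant majorant -/

section DominatedKernels

open scoped ENNReal

variable {h : ℝ → ℝ≥0∞} {q : ℝ}

/-- The mass which the translate `h (· - y)` puts on the interval between `a` and `b`. It majorises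
`∫ s in a..b, G s y` for every kernel with `‖G s y‖ₑ ≤ h (s - y)`. -/
def windowMass (h : ℝ → ℝ≥0∞) (a b y : ℝ) : ℝ≥0∞ := ∫⁻ s in Set.uIoc a b, h (s - y)

lemma measurable_windowMass (hh : Measurable h) (a b : ℝ) : Measurable (windowMass h a b) := by
  have hsub : Measurable fun p : ℝ × ℝ => h (p.2 - p.1) := by fun_prop
  exact hsub.lintegral_prod_right'

lemma volume_uIoc (a b : ℝ) : volume (Set.uIoc a b) = edist a b := by
  rw [Set.uIoc, Real.volume_Ioc, max_sub_min_eq_abs, edist_comm, edist_dist, Real.dist_eq]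

lemma lintegral_windowMass (hh : Measurable h) (a b : ℝ) :
    ∫⁻ y, windowMass h a b y = edist a b * ∫⁻ u, h u :=
  calc ∫⁻ y, windowMass h a b y
      = ∫⁻ s in Set.uIoc a b, ∫⁻ y, h (s - y) := lintegral_lintegral_swap (by fun_prop)
    _ = edist a b * ∫⁻ u, h u := by
      simp only [lintegral_sub_left_eq_self, lintegral_const, Measure.restrict_apply_univ,
        volume_uIoc, mul_comm]

lemma windowMass_le_lintegral (h : ℝ → ℝ≥0∞) (a b y : ℝ) : windowMass h a b y ≤ ∫⁻ u, h u :=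
  (setLIntegral_le_lintegral _ _).trans (lintegral_sub_right_eq_self h y).le

lemma windowMass_le_rpow (hh : Measurable h) (hq : 1 < q) (a b y : ℝ) :
    windowMass h a b y ≤ (∫⁻ u, h u ^ q) ^ (1 / q) * edist a b ^ (1 - 1 / q) := by
  have hpq := Real.HolderConjugate.conjExponent hq
  have hexp : 1 / q.conjExponent = 1 - 1 / q := by
    rw [one_div, one_div]
    linarith [hpq.inv_add_inv_eq_one]
  have holder := ENNReal.lintegral_mul_le_Lp_mul_Lq (volume.restrict (Set.uIoc a b)) hpq
    (f := fun s => h (s - y)) (g := 1) (by fun_prop) aemeasurable_const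
  simp only [Pi.mul_apply, Pi.one_apply, mul_one, ENNReal.one_rpow, lintegral_const, one_mul,
    Measure.restrict_apply_univ, volume_uIoc, hexp] at holder
  grw [windowMass, holder, ← windowMass_le_lintegral (fun u => h u ^ q) a b y, windowMass]

lemma enorm_intervalIntegral_le_windowMass {g : ℝ → ℝ} {y : ℝ}
    (hg : ∀ s, s ≠ y → ‖g s‖ₑ ≤ h (s - y)) (a b : ℝ) :
    ‖∫ s in a..b, g s‖ₑ ≤ windowMass h a b y := by
  rw [← ofReal_norm, intervalIntegral.norm_integral_eq_norm_integral_uIoc, ofReal_norm]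
  refine (enorm_integral_le_lintegral_enorm _).trans (lintegral_mono_ae (ae_restrict_of_ae ?_))
  filter_upwards [Measure.ae_ne volume y] with s hs using hg s hs

lemma integrable_of_enorm_le_sub (hI : ∫⁻ u, h u ≠ ⊤) {g : ℝ → ℝ} {y : ℝ} (hgm : Measurable g)
    (hg : ∀ s, s ≠ y → ‖g s‖ₑ ≤ h (s - y)) : Integrable g := by
  refine ⟨hgm.aestronglyMeasurable, (lintegral_mono_ae ?_).trans_lt
    ((lintegral_sub_right_eq_self h y).trans_lt hI.lt_top)⟩
  filter_upwards [Measure.ae_ne volume y] with s hs using hg s hs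

lemma measurable_intervalIntegral_left {G : ℝ → ℝ → ℝ} (hG : Measurable (Function.uncurry G))
    (a b : ℝ) : Measurable fun y => ∫ s in a..b, G s y := by
  have hinteg (A : Set ℝ) : Measurable fun y => ∫ s in A, G s y :=
    hG.stronglyMeasurable.integral_prod_left'.measurable
  exact (hinteg _).sub (hinteg _)

/-- Of the two factors of the square, the first is bounded by Hölder's inequality and the second is
integrated over `y`; the order of the increment then exceeds `1`, as Kolmogorov's criterion
requires. -/
lemma lintegral_sq_intervalIntegral_sub_le (hh : Measurable h) (hI : ∫⁻ u, h u ≠ ⊤) (hq : 1 < q)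
    {G : ℝ → ℝ → ℝ} (hGm : Measurable (Function.uncurry G))
    (hG : ∀ s y, s ≠ y → ‖G s y‖ₑ ≤ h (s - y)) (a s t : ℝ) :
    ∫⁻ y, ‖(∫ u in a..s, G u y) - ∫ u in a..t, G u y‖ₑ ^ 2
      ≤ (∫⁻ u, h u ^ q) ^ (1 / q) * (∫⁻ u, h u) * edist s t ^ (2 - 1 / q) := by
  have hincr (y : ℝ) : ‖(∫ u in a..s, G u y) - ∫ u in a..t, G u y‖ₑ ≤ windowMass h t s y := by
    have hinteg : Integrable (G · y) :=
      integrable_of_enorm_le_sub hI (hGm.comp measurable_prodMk_right) (hG · y)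
    rw [intervalIntegral.integral_interval_sub_left hinteg.intervalIntegrable
      hinteg.intervalIntegrable]
    exact enorm_intervalIntegral_le_windowMass (hG · y) t s
  have hpow : edist s t ^ (2 - 1 / q) = edist s t ^ (1 - 1 / q) * edist s t := by
    have hq' : 0 ≤ 1 - 1 / q := sub_nonneg.2 ((div_le_one (by linarith)).2 hq.le)
    rw [show 2 - 1 / q = 1 - 1 / q + 1 by ring, ENNReal.rpow_add_of_nonneg _ _ hq' zero_le_one,
      ENNReal.rpow_one]
  calc ∫⁻ y, ‖(∫ u in a..s, G u y) - ∫ u in a..t, G u y‖ₑ ^ 2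
      ≤ ∫⁻ y, (∫⁻ u, h u ^ q) ^ (1 / q) * edist t s ^ (1 - 1 / q) * windowMass h t s y := by
        refine lintegral_mono fun y => ?_
        grw [hincr y, sq]
        gcongr
        exact windowMass_le_rpow hh hq t s y
    _ = (∫⁻ u, h u ^ q) ^ (1 / q) * (∫⁻ u, h u) * edist s t ^ (2 - 1 / q) := by
        rw [lintegral_const_mul _ (measurable_windowMass hh t s), lintegral_windowMass hh,
          hpow, edist_comm]
        ring

lemma lintegral_sq_sum_windowMass_ne_top (hh : Measurable h) (hI : ∫⁻ u, h u ≠ ⊤) {ι : Type*}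
    (F : Finset ι) (c : ι → ℝ) (a : ℝ) (b : ι → ℝ) :
    ∫⁻ y, (∑ i ∈ F, ‖c i‖ₑ * windowMass h a (b i) y) ^ 2 ≠ ⊤ := by
  have hsum : ∑ i ∈ F, ‖c i‖ₑ * ∫⁻ u, h u ≠ ⊤ :=
    ENNReal.sum_ne_top.2 fun i _ => ENNReal.mul_ne_top enorm_ne_top hI
  have hinteg : ∫⁻ y, ∑ i ∈ F, ‖c i‖ₑ * windowMass h a (b i) y ≠ ⊤ := by
    rw [lintegral_finsetSum _ fun i _ => (measurable_windowMass hh a (b i)).const_mul _]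
    simp only [lintegral_const_mul _ (measurable_windowMass hh _ _), lintegral_windowMass hh]
    exact ENNReal.sum_ne_top.2 fun i _ =>
      ENNReal.mul_ne_top enorm_ne_top (ENNReal.mul_ne_top (edist_ne_top _ _) hI)
  refine ne_top_of_le_ne_top (ENNReal.mul_ne_top hsum hinteg) ?_
  rw [← lintegral_const_mul' _ _ hsum]
  refine lintegral_mono fun y => ?_
  rw [sq]
  gcongr
  exact windowMass_le_lintegral h a _ y

lemma tendsto_intervalIntegral_of_enorm_le_sub (hh : Measurable h) (hI : ∫⁻ u, h u ≠ ⊤)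
    {g : ℕ → ℝ → ℝ} {g' : ℝ → ℝ} {y : ℝ} (hgm : ∀ n, Measurable (g n))
    (hg : ∀ᶠ n in atTop, ∀ s, s ≠ y → ‖g n s‖ₑ ≤ h (s - y))
    (hlim : ∀ s, s ≠ y → Tendsto (fun n => g n s) atTop (𝓝 (g' s))) (a b : ℝ) :
    Tendsto (fun n => ∫ s in a..b, g n s) atTop (𝓝 (∫ s in a..b, g' s)) := by
  have hhm : Measurable fun s => h (s - y) := by fun_prop
  have hhy : ∫⁻ s, h (s - y) ≠ ⊤ := (lintegral_sub_right_eq_self h y).trans_ne hI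
  refine intervalIntegral.tendsto_integral_filter_of_dominated_convergence
    (fun s => (h (s - y)).toReal) (Eventually.of_forall fun n => (hgm n).aestronglyMeasurable) ?_
    (integrable_toReal_of_lintegral_ne_top hhm.aemeasurable hhy).intervalIntegrable ?_
  · filter_upwards [hg] with n hn
    filter_upwards [Measure.ae_ne volume y, ae_lt_top hhm hhy] with s hs hfin _
    simpa using ENNReal.toReal_mono hfin.ne (hn s hs)
  · filter_upwards [Measure.ae_ne volume y] with s hs _ using hlim s hs

lemma enorm_sum_intervalIntegral_le {g : ℝ → ℝ} {y : ℝ} (hg : ∀ s, s ≠ y → ‖g s‖ₑ ≤ h (s - y))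
    {ι : Type*} (F : Finset ι) (c : ι → ℝ) (a : ℝ) (b : ι → ℝ) :
    ‖∑ i ∈ F, c i * ∫ s in a..b i, g s‖ₑ ≤ ∑ i ∈ F, ‖c i‖ₑ * windowMass h a (b i) y := by
  refine (enorm_sum_le _ _).trans (Finset.sum_le_sum fun i _ => ?_)
  rw [enorm_mul]
  gcongr
  exact enorm_intervalIntegral_le_windowMass hg a (b i)

lemma memLp_two_intervalIntegral (hh : Measurable h) (hI : ∫⁻ u, h u ≠ ⊤) {G : ℝ → ℝ → ℝ}
    (hGm : Measurable (Function.uncurry G)) (hG : ∀ s y, s ≠ y → ‖G s y‖ₑ ≤ h (s - y)) (a b : ℝ) :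
    MemLp (fun y => ∫ s in a..b, G s y) 2 := by
  refine ⟨(measurable_intervalIntegral_left hGm a b).aestronglyMeasurable, ?_⟩
  refine (ENNReal.pow_lt_top_iff.1 ?_).resolve_right two_ne_zero
  rw [sq_eLpNorm_two]
  refine (lintegral_mono fun y => ?_).trans_lt
    (lintegral_sq_sum_windowMass_ne_top hh hI {()} (fun _ => 1) a fun _ => b).lt_top
  simpa using pow_le_pow_left₀ zero_le (enorm_intervalIntegral_le_windowMass (hG · y) a b) 2

lemma tendsto_lintegral_sq_sum_intervalIntegral (hh : Measurable h) (hI : ∫⁻ u, h u ≠ ⊤)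
    {G : ℕ → ℝ → ℝ → ℝ} {G' : ℝ → ℝ → ℝ} (hGm : ∀ n, Measurable (Function.uncurry (G n)))
    (hG : ∀ᶠ n in atTop, ∀ s y, s ≠ y → ‖G n s y‖ₑ ≤ h (s - y))
    (hlim : ∀ s y, s ≠ y → Tendsto (fun n => G n s y) atTop (𝓝 (G' s y)))
    {ι : Type*} (F : Finset ι) (c : ι → ℝ) (a : ℝ) (b : ι → ℝ) :
    Tendsto (fun n => ∫⁻ y, ‖∑ i ∈ F, c i * ∫ s in a..b i, G n s y‖ₑ ^ 2) atTop
      (𝓝 (∫⁻ y, ‖∑ i ∈ F, c i * ∫ s in a..b i, G' s y‖ₑ ^ 2)) := by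
  refine tendsto_lintegral_filter_of_dominated_convergence
    (fun y => (∑ i ∈ F, ‖c i‖ₑ * windowMass h a (b i) y) ^ 2) (Eventually.of_forall fun n => ?_) ?_
    (lintegral_sq_sum_windowMass_ne_top hh hI F c a b) (ae_of_all _ fun y => ?_)
  · exact (Finset.measurable_fun_sum F fun i _ =>
      (measurable_intervalIntegral_left (hGm n) a (b i)).const_mul _).enorm.pow_const 2
  · filter_upwards [hG] with n hn
    exact ae_of_all _ fun y =>
      pow_le_pow_left₀ zero_le (enorm_sum_intervalIntegral_le (hn · y) F c a b) 2
  · have hlim_y (t : ℝ) : Tendsto (fun n => ∫ s in a..t, G n s y) atTop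
        (𝓝 (∫ s in a..t, G' s y)) :=
      tendsto_intervalIntegral_of_enorm_le_sub hh hI
        (fun n => (hGm n).comp measurable_prodMk_right) (hG.mono fun n hn => (hn · y)) (hlim · y)
        a t
    exact ((ENNReal.continuous_pow 2).tendsto _).comp
      (tendsto_finsetSum F fun i _ => (hlim_y (b i)).const_mul (c i)).enorm

end DominatedKernels

/-! ### The weights of the noise variables -/

section NoiseWeight

open scoped NNReal ENNReal

variable {α lam H : ℝ}

lemma integral_comp_floor (x : ℤ → ℝ) {N : ℕ} {t : ℝ} (hNt : N ≤ t) (htN : t ≤ N + 1) :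
    IntervalIntegrable (fun u => x (⌊u⌋ + 1)) volume N t ∧
      ∫ u in (N : ℝ)..t, x (⌊u⌋ + 1) = (t - N) * x (N + 1) := by
  have hae : ∀ᵐ u : ℝ, u ∈ Set.uIoc (N : ℝ) t → x (N + 1) = x (⌊u⌋ + 1) := by
    filter_upwards [Measure.ae_ne volume ((N : ℝ) + 1)] with u hu hmem
    rw [Set.uIoc_of_le hNt] at hmem
    have hfloor : ⌊u⌋ = (N : ℤ) :=
      Int.floor_eq_iff.2 ⟨mod_cast hmem.1.le, mod_cast (hmem.2.trans htN).lt_of_ne hu⟩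
    rw [hfloor]
  exact ⟨intervalIntegrable_const.congr_ae ((ae_restrict_iff' measurableSet_uIoc).2 hae),
    by rw [← intervalIntegral.integral_congr_ae hae, intervalIntegral.integral_const, smul_eq_mul]⟩

lemma integral_comp_floor_natCast (x : ℤ → ℝ) (N : ℕ) :
    IntervalIntegrable (fun u => x (⌊u⌋ + 1)) volume 0 N ∧
      ∫ u in (0 : ℝ)..N, x (⌊u⌋ + 1) = ∑ k ∈ Finset.Icc 1 N, x k := by
  induction N with
  | zero => simp
  | succ N ih =>
    obtain ⟨hinteg, hval⟩ :=
      integral_comp_floor x (N := N) (t := (N + 1 : ℕ)) (by push_cast; linarith) (by simp)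
    refine ⟨ih.1.trans hinteg, ?_⟩
    rw [← intervalIntegral.integral_add_adjacent_intervals ih.1 hinteg, ih.2, hval,
      Finset.sum_Icc_succ_top N.succ_pos]
    push_cast
    ring

lemma partialSum_eq_integral (x : ℤ → ℝ) {t : ℝ} (ht : 0 ≤ t) :
    partialSum x t = ∫ u in (0 : ℝ)..t, x (⌊u⌋ + 1) := by
  obtain ⟨hinteg, hval⟩ := integral_comp_floor_natCast x ⌊t⌋₊
  obtain ⟨hinteg', hval'⟩ :=
    integral_comp_floor x (Nat.floor_le ht) (Nat.lt_floor_add_one t).le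
  rw [← intervalIntegral.integral_add_adjacent_intervals hinteg hinteg', hval, hval', partialSum]

lemma hasSum_intCoeff {z : ℤ → ℝ} {k : ℤ} (h : Summable fun j : ℕ => coeff (-α) lam j * z (k - j)) :
    HasSum (fun i : ℤ => intCoeff α lam (k - i) * z i) (temperedDiff (-α) lam z k) := by
  have hinj : Function.Injective fun j : ℕ => k - (j : ℤ) := fun a b hab => by simpa using hab
  refine (hinj.hasSum_iff fun i hi => ?_).1 (h.hasSum.congr_fun fun j => by simp [intCoeff])
  have hneg : ¬0 ≤ k - i := fun h0 => hi ⟨(k - i).toNat, by simp [Int.toNat_of_nonneg h0]⟩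
  rw [intCoeff, if_neg hneg, zero_mul]

lemma hasSum_partialSum {c : ℤ → ℤ → ℝ} {z x : ℤ → ℝ}
    (h : ∀ k, HasSum (fun i => c k i * z i) (x k)) (t : ℝ) :
    HasSum (fun i => partialSum (c · i) t * z i) (partialSum x t) := by
  refine ((hasSum_sum fun (k : ℕ) (_ : k ∈ Finset.Icc 1 ⌊t⌋₊) => h k).add
    ((h ((⌊t⌋₊ : ℤ) + 1)).mul_left (t - ⌊t⌋₊))).congr_fun fun i => ?_
  rw [partialSum, add_mul, Finset.sum_mul, mul_assoc]

/-- The coefficient of the noise variable `Z i` in the rescaled path at time `t`. -/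
def noiseWeight (α lam H : ℝ) (n : ℕ) (t : unitInterval) (i : ℤ) : ℝ :=
  scaledPath H n (fun k => intCoeff α (lam / n) (k - i)) t

lemma hasSum_noiseWeight_mul {n : ℕ} {z : ℤ → ℝ}
    (h : ∀ k, Summable fun j : ℕ => coeff (-α) (lam / n) j * z (k - j)) (t : unitInterval) :
    HasSum (fun i => noiseWeight α lam H n t i * z i)
      (scaledPath H n (temperedDiff (-α) (lam / n) z) t) :=
  ((hasSum_partialSum (fun k => hasSum_intCoeff (h k)) (n * (t : ℝ))).mul_left
    ((n : ℝ) ^ (-H))).congr_fun fun _ => mul_assoc _ _ _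

lemma noiseWeight_floor_add_one (hH : H = α + 1 / 2) {n : ℕ} (hn : 1 ≤ n) (t : unitInterval)
    (y : ℝ) : noiseWeight α lam H n t (⌊n * y⌋ + 1) =
      (√n)⁻¹ * ∫ s in (0 : ℝ)..t, stepKernel α lam n s y := by
  have hn0 : (0 : ℝ) < n := by exact_mod_cast hn
  have hpow : (n : ℝ) ^ (-H) * n = (√n)⁻¹ * (n : ℝ) ^ (1 - α) := by
    rw [Real.sqrt_eq_rpow, ← Real.rpow_neg hn0.le, ← Real.rpow_add hn0, ← Real.rpow_add_one hn0.ne',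
      hH]
    ring_nf
  calc noiseWeight α lam H n t (⌊n * y⌋ + 1)
      = (n : ℝ) ^ (-H) *
          ∫ u in (0 : ℝ)..n * t, intCoeff α (lam / n) (⌊u⌋ + 1 - (⌊n * y⌋ + 1)) := by
        rw [← partialSum_eq_integral (fun k => intCoeff α (lam / n) (k - (⌊n * y⌋ + 1)))
          (mul_nonneg hn0.le t.2.1)]
        rfl
    _ = (n : ℝ) ^ (-H) * n * ∫ s in (0 : ℝ)..t, intCoeff α (lam / n) (⌊n * s⌋ - ⌊n * y⌋) := by
        have hscale := intervalIntegral.mul_integral_comp_mul_left (a := 0) (b := (t : ℝ))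
          (f := fun u => intCoeff α (lam / n) (⌊u⌋ - ⌊n * y⌋)) (c := n)
        rw [mul_zero] at hscale
        simp only [add_sub_add_right_eq_sub, ← hscale, mul_assoc]
    _ = (√n)⁻¹ * ∫ s in (0 : ℝ)..t, stepKernel α lam n s y := by
        simp only [hpow, stepKernel, intervalIntegral.integral_const_mul, mul_assoc]

lemma lintegral_comp_floor (g : ℤ → ℝ≥0∞) {n : ℕ} (hn : 1 ≤ n) :
    ∫⁻ y : ℝ, g ⌊n * y⌋ = (n : ℝ≥0∞)⁻¹ * ∑' i, g i := by
  have hn0 : (0 : ℝ) < n := by exact_mod_cast hn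
  have hfloor : Measurable fun y : ℝ => ⌊n * y⌋ := by fun_prop
  have hcell (i : ℤ) : volume.map (fun y : ℝ => ⌊n * y⌋) {i} = (n : ℝ≥0∞)⁻¹ := by
    have hIco : (fun y : ℝ => ⌊n * y⌋) ⁻¹' {i} = Set.Ico (i / n : ℝ) ((i + 1) / n) := by
      ext y
      simp only [Set.mem_preimage, Set.mem_singleton_iff, Int.floor_eq_iff, Set.mem_Ico,
        div_le_iff₀ hn0, lt_div_iff₀ hn0, mul_comm y]
    rw [Measure.map_apply hfloor (measurableSet_singleton i), hIco, Real.volume_Ico, ← sub_div,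
      add_sub_cancel_left, one_div, ENNReal.ofReal_inv_of_pos hn0, ENNReal.ofReal_natCast]
  rw [← lintegral_map measurable_from_top hfloor, lintegral_countable', ← ENNReal.tsum_mul_left]
  exact tsum_congr fun i => by rw [hcell, mul_comm]

lemma tsum_sq_enorm_eq_lintegral {n : ℕ} (hn : 1 ≤ n) {F : ℤ → ℝ} {g : ℝ → ℝ}
    (h : ∀ y : ℝ, F (⌊n * y⌋ + 1) = (√n)⁻¹ * g y) : ∑' i, ‖F i‖ₑ ^ 2 = ∫⁻ y, ‖g y‖ₑ ^ 2 := by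
  have hn0 : (0 : ℝ) < n := by exact_mod_cast hn
  have hg (y : ℝ) : ‖g y‖ₑ ^ 2 = n * ‖F (⌊n * y⌋ + 1)‖ₑ ^ 2 := by
    rw [enorm_sq_eq_ofReal, enorm_sq_eq_ofReal, ← ENNReal.ofReal_natCast,
      ← ENNReal.ofReal_mul hn0.le, h, mul_pow, inv_pow, Real.sq_sqrt hn0.le,
      mul_inv_cancel_left₀ hn0.ne']
  calc ∑' i, ‖F i‖ₑ ^ 2
      = ∑' i, ‖F (i + 1)‖ₑ ^ 2 := ((Equiv.addRight (1 : ℤ)).tsum_eq fun i => ‖F i‖ₑ ^ 2).symm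
    _ = n * ((n : ℝ≥0∞)⁻¹ * ∑' i, ‖F (i + 1)‖ₑ ^ 2) := by
        rw [ENNReal.mul_inv_cancel_left (by simpa using hn0.ne') (ENNReal.natCast_ne_top n)]
    _ = ∫⁻ y, ‖g y‖ₑ ^ 2 := by
        simp only [hg]
        rw [lintegral_const_mul' _ _ (ENNReal.natCast_ne_top n),
          lintegral_comp_floor (fun i => ‖F (i + 1)‖ₑ ^ 2) hn]

lemma thpKernel_eq (hH : H = α + 1 / 2) (t y : ℝ) :
    thpKernel H lam t y = ∫ s in (0 : ℝ)..t, temperedKernel α lam s y := by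
  simp only [thpKernel, temperedKernel, show H - 3 / 2 = α - 1 by linarith]

lemma memLp_thpKernel (hα : 0 < α) (hlam : 0 < lam) (hH : H = α + 1 / 2) (t : ℝ) :
    MemLp (thpKernel H lam t) 2 := by
  obtain ⟨h, hh, hI, -, -, htemp⟩ := exists_kernel_majorant hα hlam
  simpa only [← thpKernel_eq hH] using!
    memLp_two_intervalIntegral hh hI (measurable_temperedKernel α lam) htemp 0 t

lemma exists_sq_increment_le (hα : 0 < α) (hlam : 0 < lam) (hH : H = α + 1 / 2) :
    ∃ (C : ℝ≥0) (r : ℝ), 1 < r ∧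
      (∀ n : ℕ, 1 ≤ n → ∀ s t : unitInterval,
        ∑' i, ‖noiseWeight α lam H n s i - noiseWeight α lam H n t i‖ₑ ^ 2 ≤ C * edist s t ^ r) ∧
      ∀ s t : unitInterval,
        ∫⁻ y, ‖thpKernel H lam s y - thpKernel H lam t y‖ₑ ^ 2 ≤ C * edist s t ^ r := by
  obtain ⟨h, hh, hI, ⟨q, hq, hIq⟩, hstep, htemp⟩ := exists_kernel_majorant hα hlam
  have hC : (∫⁻ u, h u ^ q) ^ (1 / q) * ∫⁻ u, h u ≠ ⊤ :=
    ENNReal.mul_ne_top (ENNReal.rpow_ne_top_of_nonneg (by positivity) hIq) hI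
  refine ⟨((∫⁻ u, h u ^ q) ^ (1 / q) * ∫⁻ u, h u).toNNReal, 2 - 1 / q, ?_,
    fun n hn s t => ?_, fun s t => ?_⟩
  · linarith [(div_lt_one (by linarith)).2 hq]
  · rw [ENNReal.coe_toNNReal hC, tsum_sq_enorm_eq_lintegral hn fun y => by
      rw [noiseWeight_floor_add_one hH hn, noiseWeight_floor_add_one hH hn, ← mul_sub]]
    exact lintegral_sq_intervalIntegral_sub_le hh hI hq (measurable_stepKernel α lam n)
      (hstep n hn) 0 s t
  · simp only [ENNReal.coe_toNNReal hC, thpKernel_eq hH]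
    exact lintegral_sq_intervalIntegral_sub_le hh hI hq (measurable_temperedKernel α lam) htemp
      0 s t

lemma exists_abs_noiseWeight_le (hα : 0 < α) (hlam : 0 < lam) (hH : H = α + 1 / 2) :
    ∃ M : ℝ, ∀ n : ℕ, 1 ≤ n → ∀ t i, |noiseWeight α lam H n t i| ≤ (√n)⁻¹ * M := by
  obtain ⟨h, -, hI, -, hstep, -⟩ := exists_kernel_majorant hα hlam
  refine ⟨(∫⁻ u, h u).toReal, fun n hn t i => ?_⟩
  have hn0 : (0 : ℝ) < n := by exact_mod_cast hn
  obtain ⟨y, rfl⟩ : ∃ y : ℝ, ⌊n * y⌋ + 1 = i :=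
    ⟨(i - 1 : ℤ) / n, by rw [mul_div_cancel₀ _ hn0.ne', Int.floor_intCast, sub_add_cancel]⟩
  rw [noiseWeight_floor_add_one hH hn, abs_mul, abs_of_nonneg (by positivity)]
  gcongr
  simpa using ENNReal.toReal_mono hI
    ((enorm_intervalIntegral_le_windowMass (hstep n hn · y) 0 t).trans
      (windowMass_le_lintegral h 0 t y))

lemma tendsto_tsum_sq_sum_noiseWeight (hα : 0 < α) (hlam : 0 < lam) (hH : H = α + 1 / 2)
    {ι : Type*} (F : Finset ι) (τ : ι → unitInterval) (θ : ι → ℝ) :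
    Tendsto (fun n => ∑' i, ‖∑ l ∈ F, θ l * noiseWeight α lam H n (τ l) i‖ₑ ^ 2) atTop
      (𝓝 (∫⁻ y, ‖(Real.Gamma α)⁻¹ * ∑ l ∈ F, θ l * thpKernel H lam (τ l) y‖ₑ ^ 2)) := by
  obtain ⟨h, hh, hI, -, hstep, -⟩ := exists_kernel_majorant hα hlam
  have hlim := tendsto_lintegral_sq_sum_intervalIntegral hh hI (measurable_stepKernel α lam)
    ((eventually_ge_atTop 1).mono hstep) (fun s y hsy => tendsto_stepKernel hα hsy) F θ 0
    fun l => (τ l : ℝ)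
  simp only [intervalIntegral.integral_const_mul, ← thpKernel_eq hH, mul_left_comm (θ _),
    ← Finset.mul_sum] at hlim
  refine hlim.congr' ?_
  filter_upwards [eventually_ge_atTop 1] with n hn
  refine (tsum_sq_enorm_eq_lintegral hn fun y => ?_).symm
  simp only [noiseWeight_floor_add_one hH hn, mul_left_comm (θ _), ← Finset.mul_sum]

end NoiseWeight

/-! ### The rescaled partial sums and the tempered Hermite process -/

section Convergence

open scoped NNReal ENNReal

variable {α lam H : ℝ} {Ω : Type*} [MeasurableSpace Ω] {P : Measure Ω}

lemma isAEKolmogorovProcess_mono {T E : Type*} [PseudoEMetricSpace T] [EMetricSpace E]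
    {X : T → Ω → E} {p q : ℝ} {M M' : ℝ≥0}
    (hX : IsAEKolmogorovProcess X P p q M) (hM : M ≤ M') : IsAEKolmogorovProcess X P p q M' := by
  obtain ⟨Y, hY, hXY⟩ := hX
  refine ⟨Y, ⟨hY.measurablePair, fun s t => (hY.kolmogorovCondition s t).trans ?_,
    hY.p_pos, hY.q_pos⟩, hXY⟩
  gcongr

section Noise

variable [IsProbabilityMeasure P] {Z : ℤ → Ω → ℝ}

lemma ae_summable_artfima (hα : 0 < α) (hlam : 0 < lam)
    (hident : ∀ j, IdentDistrib (Z j) (Z 0) P P) (hvar : MemLp (Z 0) 2 P) (k : ℤ) :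
    ∀ᵐ ω ∂P, Summable fun j : ℕ => |coeff (-α) lam j * Z (k - j) ω| :=
  ae_summable_abs_weighted (fun j : ℕ => hident (k - j)) (hvar.integrable one_le_two)
    (summable_abs_coeff_neg hα hlam)

lemma ae_hasSum_scaledPath_artfima (hα : 0 < α) (hlam : 0 < lam)
    (hident : ∀ j, IdentDistrib (Z j) (Z 0) P P) (hvar : MemLp (Z 0) 2 P) (H : ℝ) {n : ℕ}
    (hn : 1 ≤ n) :
    ∀ᵐ ω ∂P, ∀ t, HasSum (fun i => noiseWeight α lam H n t i * Z i ω)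
      (scaledPath H n (fun k => artfima α (lam / n) Z k ω) t) := by
  have hlam_n : 0 < lam / n := div_pos hlam (by exact_mod_cast hn)
  filter_upwards [ae_all_iff.2 fun k => ae_summable_artfima hα hlam_n hident hvar k] with ω hω t
  exact hasSum_noiseWeight_mul (z := fun i => Z i ω) (fun k => (hω k).of_abs) t

lemma isAEKolmogorovProcess_scaledPath (hα : 0 < α) (hlam : 0 < lam) (hH : H ≠ 0)
    (hindep : iIndepFun Z P) (hident : ∀ j, IdentDistrib (Z j) (Z 0) P P)
    (hmean : ∫ ω, Z 0 ω ∂P = 0) (hvar : MemLp (Z 0) 2 P) {C : ℝ≥0} {r : ℝ} (hr : 0 < r)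
    (hC : ∀ n : ℕ, 1 ≤ n → ∀ s t : unitInterval,
      ∑' i, ‖noiseWeight α lam H n s i - noiseWeight α lam H n t i‖ₑ ^ 2 ≤ C * edist s t ^ r)
    (n : ℕ) :
    IsAEKolmogorovProcess (fun t ω => scaledPath H n (fun k => artfima α (lam / n) Z k ω) t) P 2 r
      (Var[Z 0; P].toNNReal * C) := by
  rcases Nat.eq_zero_or_pos n with rfl | hn
  · have hzero (x : ℤ → ℝ) (t : unitInterval) : scaledPath H 0 x t = 0 := by
      simp [scaledPath, Real.zero_rpow (neg_ne_zero.2 hH)]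
    refine isAEKolmogorovProcess_of_sq_eLpNorm_sub_le (fun t => ?_) hr fun s t => ?_
    · simpa only [hzero] using aemeasurable_const
    · simp [hzero]
  · have hsum := ae_hasSum_scaledPath_artfima hα hlam hident hvar H hn
    refine isAEKolmogorovProcess_of_sq_eLpNorm_sub_le (fun t => ?_) hr fun s t => ?_
    · exact aemeasurable_of_ae_hasSum
        (fun i => ((hident i).aemeasurable_fst.const_mul _)) (hsum.mono fun ω hω => hω t)
    · have hdiff := sq_eLpNorm_weighted_sum_le hindep hident hvar hmean (hsum.mono fun ω hω =>
        ((hω s).sub (hω t)).congr_fun fun i => sub_mul _ _ _)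
      grw [ENNReal.coe_mul, mul_assoc, ← hC n hn s t]
      exact hdiff

lemma tendsto_charFun_sum_scaledPath (hα : 0 < α) (hlam : 0 < lam) (hH : H = α + 1 / 2)
    (hindep : iIndepFun Z P) (hident : ∀ j, IdentDistrib (Z j) (Z 0) P P)
    (hmean : ∫ ω, Z 0 ω ∂P = 0) (hvar : MemLp (Z 0) 2 P) {ι : Type*} (F : Finset ι)
    (τ : ι → unitInterval) (θ : ι → ℝ) (u : ℝ) :
    Tendsto (fun n : ℕ => charFun (P.map fun ω =>
        ∑ l ∈ F, θ l * scaledPath H n (fun k => artfima α (lam / n) Z k ω) (τ l)) u) atTop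
      (𝓝 (gaussianCharFun (Var[Z 0; P] * (∫⁻ y,
        ‖(Real.Gamma α)⁻¹ * ∑ l ∈ F, θ l * thpKernel H lam (τ l) y‖ₑ ^ 2).toReal) u)) := by
  obtain ⟨M, hM⟩ := exists_abs_noiseWeight_le hα hlam hH
  have hL2 : MemLp (fun y => (Real.Gamma α)⁻¹ * ∑ l ∈ F, θ l * thpKernel H lam (τ l) y) 2 :=
    (memLp_finsetSum F fun l _ => (memLp_thpKernel hα hlam hH (τ l)).const_mul (θ l)).const_mul _
  refine tendsto_charFun_weighted_sum hindep hident hvar hmean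
    (b := fun n : ℕ => (∑ l ∈ F, |θ l|) * ((√n)⁻¹ * M)) ?_ ?_ ?_ ?_
    (tendsto_tsum_sq_sum_noiseWeight hα hlam hH F τ θ) u
  · filter_upwards [eventually_ge_atTop 1] with n hn
    filter_upwards [ae_hasSum_scaledPath_artfima hα hlam hident hvar H hn] with ω hω
    refine (hasSum_sum fun l (_ : l ∈ F) => (hω (τ l)).mul_left (θ l)).congr_fun fun i => ?_
    simp only [Finset.sum_mul, mul_assoc]
  · filter_upwards [eventually_ge_atTop 1] with n hn i
    rw [Finset.sum_mul]
    refine (Finset.abs_sum_le_sum_abs _ _).trans (Finset.sum_le_sum fun l _ => ?_)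
    grw [abs_mul, hM n hn]
  · have hsqrt : Tendsto (fun n : ℕ => (√(n : ℝ))⁻¹) atTop (𝓝 0) :=
      (Real.tendsto_sqrt_atTop.comp tendsto_natCast_atTop_atTop).inv_tendsto_atTop
    simpa using (hsqrt.mul_const M).const_mul (∑ l ∈ F, |θ l|)
  · rw [← sq_eLpNorm_two]
    exact ENNReal.pow_ne_top hL2.2.ne

end Noise

section Hermite

variable {B : Set ℝ → Ω → ℝ} {c : ℝ≥0∞}

lemma isAEKolmogorovProcess_of_isWienerIntegral (hB : IsGaussianRandomMeasure B (c • volume) P)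
    {Y : unitInterval → Ω → ℝ}
    (hY : ∀ t : unitInterval, IsWienerIntegral B (c • volume) P (thpKernel H lam t) (Y t))
    (hc : c ≠ ⊤) {C : ℝ≥0} {r : ℝ} (hr : 0 < r) (hC : ∀ s t : unitInterval,
      ∫⁻ y, ‖thpKernel H lam s y - thpKernel H lam t y‖ₑ ^ 2 ≤ C * edist s t ^ r) :
    IsAEKolmogorovProcess Y P 2 r (c.toNNReal * C) := by
  refine isAEKolmogorovProcess_of_sq_eLpNorm_sub_le
    (fun t => (hY t).2.1.aestronglyMeasurable.aemeasurable) hr fun s t => ?_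
  rw [((hY s).sub hB (hY t)).eLpNorm_eq hB, sq_eLpNorm_two, lintegral_smul_measure, smul_eq_mul,
    ENNReal.coe_mul, ENNReal.coe_toNNReal hc, mul_assoc]
  gcongr
  exact hC s t

lemma exists_isTHP (hα : 0 < α) (hlam : 0 < lam) (hH : H = α + 1 / 2)
    (hB : IsGaussianRandomMeasure B (c • volume) P) (hc : c ≠ ⊤) :
    ∃ ζ : Ω → C(unitInterval, ℝ), IsTHP B (c • volume) P H lam ζ := by
  have := hB.isProbabilityMeasure
  obtain ⟨C, r, hr, -, hC⟩ := exists_sq_increment_le hα hlam hH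
  choose Y hY using fun t : unitInterval =>
    exists_isWienerIntegral hB ((memLp_thpKernel hα hlam hH t).smul_measure hc)
  obtain ⟨ζ, hζ⟩ := exists_continuous_modification
    (isAEKolmogorovProcess_of_isWienerIntegral hB hY hc (by linarith) hC) hr
  exact ⟨ζ, fun t => (hY t).congr_ae (hζ t).symm⟩

lemma IsTHP.charFun_sum (hB : IsGaussianRandomMeasure B (c • volume) P)
    {ζ : Ω → C(unitInterval, ℝ)} (hζ : IsTHP B (c • volume) P H lam ζ) {ι : Type*} (F : Finset ι)
    (τ : ι → unitInterval) (θ : ι → ℝ) (u : ℝ) :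
    charFun (P.map fun ω => ∑ l ∈ F, θ l * ζ ω (τ l)) u = gaussianCharFun
      (c * ∫⁻ y, ‖∑ l ∈ F, θ l * thpKernel H lam (τ l) y‖ₑ ^ 2).toReal u := by
  have hlaw := (IsWienerIntegral.sum hB F (fun l _ => hζ (τ l)) θ).hasLaw hB
  have hmap := hlaw.map_eq
  simp only [Finset.sum_fn, Pi.smul_apply, smul_eq_mul, Finset.sum_apply] at hmap
  rw [hmap, charFun_gaussianReal_zero, lintegral_smul_measure, smul_eq_mul,
    ENNReal.coe_toNNReal_eq_toReal]

end Hermite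

lemma toReal_ofReal_div_sq_mul_lintegral {v g : ℝ} (hv : 0 ≤ v) (f : ℝ → ℝ) :
    (ENNReal.ofReal (v / g ^ 2) * ∫⁻ y, ‖f y‖ₑ ^ 2).toReal =
      v * (∫⁻ y, ‖g⁻¹ * f y‖ₑ ^ 2).toReal := by
  simp only [enorm_mul, mul_pow]
  rw [lintegral_const_mul' _ _ (by finiteness), ENNReal.toReal_mul, ENNReal.toReal_mul,
    ENNReal.toReal_ofReal (by positivity), ENNReal.toReal_pow, toReal_enorm, Real.norm_eq_abs,
    sq_abs, inv_pow, div_eq_mul_inv, mul_assoc]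

end Convergence

end TemperedFractional

end

open TemperedFractional in
theorem theorem5p4
    {Ω : Type*} [MeasurableSpace Ω] (P : Measure Ω) [IsProbabilityMeasure P]
    {Ω' : Type*} [MeasurableSpace Ω'] (P' : Measure Ω') [IsProbabilityMeasure P']
    (α lam H : ℝ) (hα : 0 < α) (hlam : 0 < lam) (hH : H = α + 1 / 2)
    -- the noise: i.i.d., mean zero, finite variance
    (Z : ℤ → Ω → ℝ) (hindep : iIndepFun Z P) (hident : ∀ j, IdentDistrib (Z j) (Z 0) P P)
    (hmean : ∫ ω, Z 0 ω ∂P = 0) (hvar : MemLp (Z 0) 2 P)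
    -- the Gaussian random measure, with control measure `(Var Z₀ / Γ(α)²) dx`
    (m : Measure ℝ)
    (hm : m = ENNReal.ofReal (variance (Z 0) P / Real.Gamma α ^ 2) • (volume : Measure ℝ))
    (B : Set ℝ → Ω' → ℝ) (hB : IsGaussianRandomMeasure B m P') :
    -- the series that define the ARTFIMA variables converge absolutely almost surely
    (∀ n : ℕ, 1 ≤ n → ∀ k : ℤ, ∀ᵐ ω ∂P,
      Summable fun j : ℕ => |coeff (-α) (lam / n) j * Z (k - j) ω|) ∧
    -- the limit process exists as a random element of `C[0,1]`
    (∃ ζ : Ω' → C(unitInterval, ℝ), IsTHP B m P' H lam ζ) ∧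
    -- weak convergence in `C[0,1]`
    (∀ ζ : Ω' → C(unitInterval, ℝ), IsTHP B m P' H lam ζ →
      TendstoInDistribution
        (fun (n : ℕ) (ω : Ω) => scaledPath H n (fun k => artfima α (lam / n) Z k ω))
        atTop ζ (fun _ => P) P') := by
  subst hm hH
  obtain ⟨C, r, hr, hweight, hkernel⟩ := exists_sq_increment_le hα hlam rfl
  have hr0 : 0 < r := one_pos.trans hr
  refine ⟨fun n hn k => ae_summable_artfima hα (div_pos hlam (by exact_mod_cast hn)) hident hvar k,
    exists_isTHP hα hlam rfl hB ENNReal.ofReal_ne_top, fun ζ hζ => ?_⟩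
  have hpath := isAEKolmogorovProcess_scaledPath hα hlam (by positivity) hindep hident hmean
    hvar hr0 hweight
  have hlimit := isAEKolmogorovProcess_of_isWienerIntegral hB hζ ENNReal.ofReal_ne_top hr0 hkernel
  refine tendstoInDistribution_of_isAEKolmogorovProcess hr
    (fun n => isAEKolmogorovProcess_mono (hpath n) (le_max_left _ _))
    (isAEKolmogorovProcess_mono hlimit (le_max_right _ _)) fun N τ θ => ?_
  rw [hζ.charFun_sum hB, toReal_ofReal_div_sq_mul_lintegral (variance_nonneg _ _)]
  exact tendsto_charFun_sum_scaledPath hα hlam rfl hindep hident hmean hvar _ τ θ 1
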